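/- Let $d\ge 1$, $H\in(0,1)$, and let $B=(B_t)_{t\in[0,1]}$ be an $\mathbb R^d$-valued stochastic process with $B_0=0$ almost surely whose paths are almost surely $\gamma$-Hölder continuous for every $\gamma\in(0,H)$. For a measurable function $b:[0,1]\times\mathbb R^d\to\mathbb R^d$ consider the equation $$X_t=\int_0^t b_s(X_s)\,ds+B_t,\qquad t\in[0,1], \tag{1}$$ with initial condition $x_0=0$. A weak solution of (1) is a complete filtered probability space $(\Omega,\mathbb F,\mathbb P)$ with right-continuous filtration, carrying $\mathbb F$-adapted processes $X$ and $\tilde B$ such that $\tilde B$ has the law of $B$; $\mathbb F$ does not anticipate $\tilde B$, i.e. for every $t$ and every $A\in\sigma(\tilde B)$ one has $\mathbb P(A\mid\mathcal F_t)=\mathbb P\big(A\mid\bigcap_{s>t}\sigma(\tilde B_r:r\le s)\big)$ almost surely for $t<1$, and $\mathbb P(A\mid\mathcal F_1)=\mathbf 1_A$ almost surely; $X$ has almost surely continuous paths; and almost surely $\int_0^1|b_s(X_s)|\,ds<\infty$ and (1) holds for all $t\in[0,1]$ with $\tilde B$ in place of $B$ (the integral being a Lebesgue integral). For $\alpha\in(-1,1)$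 let $C^\alpha_x$ be the inhomogeneous Besov space $B^\alpha_{\infty,\infty}(\mathbb R^d;\mathbb R^d)$ if $\alpha\ne0$, and $L^\infty(\mathbb R^d;\mathbb R^d)$ if $\alpha=0$; $L^q_tE=L^q([0,1];E)$ denotes the Bochner space, and $1/q+1/q'=1$. (i) Let $q\in(1,\infty)$ and $$-1<\alpha<1-\frac1{Hq'} .$$ Then there is a measurable function $b$, with $b_t$ continuous on $\mathbb R^d$ for every $t$, such that $b\in L^q_tC^\alpha_x$ and (1) has two weak solutions $(X^1,\tilde B^1)$, $(X^2,\tilde B^2)$ for which the laws of $X^1$ and $X^2$ on path space are different, and indeed mutually singular. (ii) Let $p,q\in[1,\infty]$ satisfy $p>d$ and $$\frac1q+\frac{Hd}{p}>1-H .$$ Then there is a measurable function $b$, with $b_t$ continuous on $\mathbb R^d$ for every $t$, such that $b\in L^q_tL^p_x$ and (1) has two weak solutions whose laws are different, and indeed mutually singular. In particular, uniqueness in law fails for such drifts. -/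

import Mathlib

open MeasureTheory ProbabilityTheory Filter
open scoped ENNReal NNReal Topology unitInterval FourierTransform

universe u

noncomputable section

namespace SingularSDE

/-- `ℝ^d` with the Euclidean norm. -/
abbrev Space (d : ℕ) : Type := EuclideanSpace ℝ (Fin d)

/-! ### The spaces `C^α` on `ℝ^d` for `α ∈ (-1, 1)` -/

/-- A smooth radial cutoff `χ`, equal to `1` on the ball of radius `3/4` and supported in the ball
of radius `4/3`. -/
def cutoff (d : ℕ) : ContDiffBump (0 : Space d) where
  rIn := 3 / 4
  rOut := 4 / 3
  rIn_pos := by norm_num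
  rIn_lt_rOut := by norm_num

/-- The dyadic partition of unity built from `χ`: index `0` is `χ` itself, and index `j + 1` is
`φ(2^{-j} ξ)` with `φ(ξ) = χ(ξ/2) - χ(ξ)`. -/
def dyadicSymbol (d : ℕ) : ℕ → Space d → ℝ
  | 0, ξ => cutoff d ξ
  | j + 1, ξ => cutoff d (((2 : ℝ) ^ (j + 1))⁻¹ • ξ) - cutoff d (((2 : ℝ) ^ j)⁻¹ • ξ)

/-- The inverse Fourier transform of the `n`-th dyadic symbol. It is real-valued, because the symbol
is real and even, so that taking the real part only changes the type. -/
def dyadicKernel (d n : ℕ) (x : Space d) : ℝ :=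
  (𝓕⁻ (fun ξ : Space d => (dyadicSymbol d n ξ : ℂ)) x).re

/-- The Littlewood-Paley blocks of a function `f`: index `0` is the low-frequency block
`Δ_{-1} f = χ(D) f`, and index `j + 1` is `Δ_j f = φ(2^{-j} D) f`. -/
def dyadicBlock {d : ℕ} (n : ℕ) (f : Space d → Space d) (x : Space d) : Space d :=
  ∫ y, dyadicKernel d n (x - y) • f y

/-- The functions that define a tempered distribution by integration. -/
def IsTempered {d : ℕ} (f : Space d → Space d) : Prop :=
  AEStronglyMeasurable f volume ∧
    ∃ N : ℕ, Integrable (fun x => ((1 + ‖x‖) ^ N)⁻¹ • f x) volume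

/-- The norm of the inhomogeneous Besov space `B^α_{∞,∞}`: the supremum over `j ≥ -1` of
`2^{jα} ‖Δ_j f‖_{L^∞}` (the index `n` below is `j + 1`). -/
def besovNorm {d : ℕ} (α : ℝ) (f : Space d → Space d) : ℝ≥0∞ :=
  ⨆ n : ℕ, ENNReal.ofReal ((2 : ℝ) ^ (((n : ℝ) - 1) * α)) * eLpNorm (dyadicBlock n f) ∞ volume

/-- The norm of `C^α`, for `α ∈ (-1, 1)`: that of `B^α_{∞,∞}` if `α ≠ 0`, that of `L^∞` if
`α = 0`. -/
def holderNorm {d : ℕ} (α : ℝ) (f : Space d → Space d) : ℝ≥0∞ :=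
  if α = 0 then eLpNorm f ∞ volume else besovNorm α f

/-- The function `f` is an element of `C^α`, for `α ∈ (-1, 1)`. -/
def MemHolder {d : ℕ} (α : ℝ) (f : Space d → Space d) : Prop :=
  IsTempered f ∧ holderNorm α f < ∞

/-! ### Bochner spaces over the time interval `[0, 1]` -/

/-- `b ∈ L^q([0,1]; V)`, for a space `V` of functions on `ℝ^d` with membership predicate `mem` and
norm `nrm`: for almost every time `b_t ∈ V`, the map `t ↦ b_t` is Bochner measurable, that is, almost
everywhere the limit in `V` of a sequence of `V`-valued simple functions, and `t ↦ ‖b_t‖_V` is in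
`L^q`. -/
def MemBochner {d : ℕ} (mem : (Space d → Space d) → Prop) (nrm : (Space d → Space d) → ℝ≥0∞)
    (q : ℝ≥0∞) (b : I → Space d → Space d) : Prop :=
  (∀ᵐ t : I, mem (b t)) ∧
  (∃ s : ℕ → SimpleFunc I (Space d → Space d), (∀ n t, mem (s n t)) ∧
    ∀ᵐ t : I, Tendsto (fun n => nrm (fun x => b t x - s n t x)) atTop (𝓝 0)) ∧
  eLpNorm (fun t : I => nrm (b t)) q volume < ∞

/-- `b ∈ L^q_t C^α_x`, for `α ∈ (-1, 1)`. -/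
def MemLqHolder {d : ℕ} (q : ℝ≥0∞) (α : ℝ) (b : I → Space d → Space d) : Prop :=
  MemBochner (MemHolder α) (holderNorm α) q b

/-- `b ∈ L^q_t L^p_x`. -/
def MemLqLp {d : ℕ} (q p : ℝ≥0∞) (b : I → Space d → Space d) : Prop :=
  MemBochner (fun f => MemLp f p volume) (fun f => eLpNorm f p volume) q b

/-- A drift with a pointwise meaning: a jointly measurable function of time and space that is
continuous in space at every time. -/
def IsPointwiseDrift {d : ℕ} (b : I → Space d → Space d) : Prop :=
  Measurable (fun z : I × Space d => b z.1 z.2) ∧ ∀ t, Continuous (b t)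

/-! ### Weak solutions -/

/-- The law of a process indexed by `[0, 1]`, as a measure on paths with the σ-algebra generated by
the evaluations. -/
def law {d : ℕ} {Ω : Type u} [MeasurableSpace Ω] (P : Measure Ω) (X : I → Ω → Space d) :
    Measure (I → Space d) :=
  P.map (fun ω t => X t ω)

/-- `(Ω, 𝔽, P; X, B)` is a weak solution on `[0, 1]` of `X_t = x₀ + ∫_0^t b_s(X_s) ds + B_t`, where
the noise `B` is required to have the law `ν`. -/
structure IsWeakSolution {d : ℕ} (b : I → Space d → Space d) (x₀ : Space d)
    (ν : Measure (I → Space d)) {Ω : Type u} [mΩ : MeasurableSpace Ω] (P : Measure Ω)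
    (𝔽 : Filtration I mΩ) (X B : I → Ω → Space d) : Prop where
  isProbabilityMeasure : IsProbabilityMeasure P
  /-- The filtration is complete and right-continuous. -/
  complete : ∀ A : Set Ω, P A = 0 → MeasurableSet[𝔽 0] A
  rightContinuous : 𝔽.IsRightContinuous
  adapted : StronglyAdapted 𝔽 X
  noise_adapted : StronglyAdapted 𝔽 B
  noise_measurable : ∀ t, StronglyMeasurable (B t)
  noise_law : law P B = ν
  /-- `𝔽` does not anticipate the noise: given `𝔽_t`, an event of the noise has the same conditional
  probability as given the past of the noise alone. For a fractional Brownian motion this says that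
  it is a fractional Brownian motion with respect to `𝔽`. -/
  nonanticipating : ∀ (t : I) (A : Set Ω),
    MeasurableSet[Filtration.natural B noise_measurable 1] A →
      P⟦A | 𝔽 t⟧ =ᵐ[P] P⟦A | (Filtration.natural B noise_measurable).rightCont t⟧
  continuous : ∀ᵐ ω ∂P, Continuous (fun t => X t ω)
  equation : ∀ᵐ ω ∂P, ∀ t : I,
    IntegrableOn (fun s : I => b s (X s ω)) (Set.Iic t) volume ∧
      X t ω = x₀ + (∫ s in Set.Iic t, b s (X s ω)) + B t ω

/-- `μ` is the law of the component `X` of some weak solution. -/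
def IsWeakSolutionLaw {d : ℕ} (b : I → Space d → Space d) (x₀ : Space d)
    (ν μ : Measure (I → Space d)) : Prop :=
  ∃ (Ω : Type u) (mΩ : MeasurableSpace Ω) (P : Measure Ω) (𝔽 : Filtration I mΩ)
    (X B : I → Ω → Space d), IsWeakSolution b x₀ ν P 𝔽 X B ∧ law P X = μ

end SingularSDE

end

/-! Fix an exponent γ < H and let the drift push away from the origin along two curves: it is γ
t^(γ-1) φ(x/λ_t) e_i, where φ is an odd, smooth, compactly supported profile equal to ±1 near ±(3/4)
e_i, and λ_t is comparable to t^γ. Almost every noise path starts at 0 and is Hölder of some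
exponent larger than γ, hence is o(t^γ). So up to some δ > 0 depending on the path, both B_t + t^γ
e_i and B_t - t^γ e_i stay where φ(·/λ_t) is 1, respectively -1, and both solve the equation exactly
(`forcing_eq`, `integral_forcing_eq`).

After time δ the drift is Lipschitz in space, so each branch continues to time 1. The continuation
is obtained by Picard iteration from ε t^γ: the iterates do not move on [0, δ] and converge on [0,
1] (`exists_tendsto_picard`). The iteration does not mention δ, which need not be a stopping time,
and it is causal; hence its limit is adapted to the augmented right-continuous filtration of the
noise, for which non-anticipation is automatic (`condExp_augmentation`). The laws are singular
because the i-th coordinate eventually has sign ε along the times 1/(n+1)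
(`repulsiveSolution_sign`).

The profile with amplitude a and scale λ ≤ 1 has C^α norm at most of order |a| λ^(-α), and L^p norm
at most of order |a| λ^(d/p). With a = γ t^(γ-1) and λ of order t^γ, the drift is in L^q in time as
soon as γ(1-α) > 1 - 1/q, respectively γ(1+d/p) > 1 - 1/q. The hypotheses are these inequalities
with H in place of γ; they are strict, so some γ < H satisfies them (`exists_exponent`). -/

namespace SingularSDE

/-! ### Completing a filtration by null sets. -/

section Augmentation

variable {Ω : Type*} {m : MeasurableSpace Ω}

/-- The augmentation of a filtration by the null sets of a complete measure. -/
def augmentation (P : Measure Ω) [P.IsComplete] (F : Filtration I m) : Filtration I m where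
  seq t := eventuallyMeasurableSpace (F t) (ae P)
  mono' := by
    rintro s t hst A ⟨A', hA', h⟩
    exact ⟨A', F.mono hst _ hA', h⟩
  le' := by
    rintro t A ⟨A', hA', h⟩
    exact (NullMeasurableSet.congr (F.le t _ hA').nullMeasurableSet h.symm).measurable_of_complete

lemma le_augmentation (P : Measure Ω) [P.IsComplete] (F : Filtration I m) (t : I) :
    F t ≤ augmentation P F t :=
  fun A hA => ⟨A, hA, EventuallyEq.rfl⟩

lemma measurableSet_augmentation_of_null {P : Measure Ω} [P.IsComplete] (F : Filtration I m)
    (t : I) {A : Set Ω} (hA : P A = 0) : MeasurableSet[augmentation P F t] A :=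
  ⟨∅, @MeasurableSet.empty _ (F t), ae_eq_empty.2 hA⟩

lemma measurable_augmentation_congr {E : Type*} [MeasurableSpace E] {P : Measure Ω}
    [P.IsComplete] (F : Filtration I m) (t : I) {f g : Ω → E}
    (hf : Measurable[augmentation P F t] f) (h : g =ᵐ[P] f) :
    Measurable[augmentation P F t] g :=
  EventuallyMeasurable.congr (m := F t) (l := ae P) hf h

/-- A set in all later augmented σ-algebras has versions A'_n in the original ones at times
decreasing to t. Their limsup depends only on the tail of the sequence, so it lies in the σ-algebra
of every time after t, and it is still a version of the set. -/
lemma augmentation_rightCont_isRightContinuous (P : Measure Ω) [P.IsComplete]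
    (F : Filtration I m) : (augmentation P F.rightCont).IsRightContinuous := by
  constructor
  intro t A hA
  by_cases ht : IsMax t
  · rwa [Filtration.rightCont_eq_of_isMax _ ht] at hA
  have hA' : ∀ s > t, MeasurableSet[augmentation P F.rightCont s] A := by
    rw [Filtration.rightCont_eq_of_not_isMax _ ht] at hA
    intro s hs
    exact (iInf₂_le s hs : (⨅ j > t, augmentation P F.rightCont j) ≤ _) A hA
  obtain ⟨s, hs_anti, hs_gt, hs_lim⟩ : ∃ s : ℕ → I, StrictAnti s ∧ (∀ n, t < s n) ∧
      Tendsto s atTop (𝓝 t) := by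
    obtain ⟨v, hv⟩ := not_isMax_iff.1 ht
    obtain ⟨s, h1, h2, h3⟩ := exists_seq_strictAnti_tendsto' hv
    exact ⟨s, h1, fun n => (h2 n).1, h3⟩
  choose A' hA'm hA'e using fun n => hA' (s n) (hs_gt n)
  refine ⟨limsup A' atTop, ?_, ?_⟩
  · change MeasurableSet[F.rightCont t] _
    rw [← Filtration.rightCont_self F, Filtration.rightCont_eq_of_not_isMax _ ht]
    rw [MeasurableSpace.measurableSet_iInf]
    intro j
    rw [MeasurableSpace.measurableSet_iInf]
    intro hj
    obtain ⟨N, hN⟩ := (hs_lim.eventually (gt_mem_nhds hj)).exists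
    have : limsup A' atTop = limsup (fun n => A' (n + N)) atTop :=
      (limsup_nat_add A' N).symm
    rw [this]
    refine @MeasurableSet.measurableSet_limsup _ (F.rightCont j) _ fun n => ?_
    refine F.rightCont.mono ?_ _ (hA'm (n + N))
    exact (hs_anti.antitone (Nat.le_add_left N n)).trans hN.le
  · have hall : ∀ᵐ ω ∂P, ∀ n, (ω ∈ A ↔ ω ∈ A' n) :=
      ae_all_iff.2 fun n => (hA'e n).mem_iff
    refine Filter.eventuallyEq_set.2 ?_
    filter_upwards [hall] with ω hω
    rw [mem_limsup_iff_frequently_mem]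
    simp [← hω]

/-- Every augmented set is almost everywhere equal to an original one, so the same function passes
the integral test on both σ-algebras. This is what makes the solutions non-anticipating. -/
lemma condExp_augmentation (P : Measure Ω) [P.IsComplete] [IsFiniteMeasure P]
    (F : Filtration I m) (t : I) {f : Ω → ℝ} (hf : Integrable f P) :
    P[f | augmentation P F t] =ᵐ[P] P[f | F t] := by
  symm
  refine ae_eq_condExp_of_forall_setIntegral_eq ((augmentation P F).le t) hf
    (fun _ _ _ => integrable_condExp.integrableOn) ?_ ?_
  · rintro A ⟨A', hA', h⟩ -
    rw [setIntegral_congr_set h, setIntegral_congr_set h,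
      setIntegral_condExp (F.le t) hf hA']
  · exact (stronglyMeasurable_condExp.mono (le_augmentation P F t)).aestronglyMeasurable

end Augmentation

/-! ### Picard iteration for a scalar equation that is Lipschitz only after time δ. -/

section Picard

/-- The Picard iterates of the scalar integral equation `y t = ∫ s in 0..t, f s (y s)`,
started from `y₀`. -/
noncomputable def picard (f : ℝ → ℝ → ℝ) (y₀ : ℝ → ℝ) : ℕ → ℝ → ℝ
  | 0 => y₀
  | k + 1 => fun t => ∫ s in (0 : ℝ)..t, f s (picard f y₀ k s)

variable {f : ℝ → ℝ → ℝ} {y₀ c : ℝ → ℝ}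

lemma intervalIntegrable_comp_of_bound (hf : Measurable (Function.uncurry f))
    (hb : ∀ s a, |f s a| ≤ |c s|) (hc : ∀ a b, IntervalIntegrable c volume a b)
    {y : ℝ → ℝ} (hy : Measurable y) (a b : ℝ) :
    IntervalIntegrable (fun s => f s (y s)) volume a b :=
  (hc a b).mono_fun (hf.comp (measurable_id.prodMk hy)).aestronglyMeasurable
    (Eventually.of_forall fun s => hb s (y s))

lemma continuous_picard (hf : Measurable (Function.uncurry f))
    (hb : ∀ s a, |f s a| ≤ |c s|) (hc : ∀ a b, IntervalIntegrable c volume a b)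
    (hy₀ : Continuous y₀) (k : ℕ) : Continuous (picard f y₀ k) := by
  induction k with
  | zero => exact hy₀
  | succ k ih =>
    exact intervalIntegral.continuous_primitive
      (intervalIntegrable_comp_of_bound hf hb hc ih.measurable) 0

/-- The starting function is a fixed point on [0, δ] and the iteration looks only at earlier times,
so no regularity of `f` in space is needed there. -/
lemma picard_eq_initial {δ : ℝ}
    (hδ : ∀ t, 0 ≤ t → t ≤ δ → ∫ s in (0 : ℝ)..t, f s (y₀ s) = y₀ t) (k : ℕ) :
    ∀ t, 0 ≤ t → t ≤ δ → picard f y₀ k t = y₀ t := by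
  induction k with
  | zero => exact fun _ _ _ => rfl
  | succ k ih =>
    intro t ht htδ
    rw [← hδ t ht htδ]
    refine intervalIntegral.integral_congr fun s hs => ?_
    rw [Set.uIcc_of_le ht] at hs
    simp only [ih s hs.1 (hs.2.trans htδ)]

/-- In the norm weighted by exp(2Lt), integrating the Lipschitz bound gains a factor 1/2 at each
step; on [0, δ] consecutive iterates agree and contribute nothing. -/
lemma abs_picard_succ_sub_le (hf : Measurable (Function.uncurry f))
    (hb : ∀ s a, |f s a| ≤ |c s|) (hc : ∀ a b, IntervalIntegrable c volume a b)
    (hy₀ : Continuous y₀) {δ L M : ℝ} (hL : 0 < L)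
    (hδ : ∀ t, 0 ≤ t → t ≤ δ → ∫ s in (0 : ℝ)..t, f s (y₀ s) = y₀ t)
    (hlip : ∀ s, δ ≤ s → s ≤ 1 → ∀ a a', |f s a - f s a'| ≤ L * |a - a'|)
    (hM : ∀ t ∈ Set.Icc (0 : ℝ) 1, |picard f y₀ 1 t - y₀ t| ≤ M) (k : ℕ) :
    ∀ t ∈ Set.Icc (0 : ℝ) 1, |picard f y₀ (k + 1) t - picard f y₀ k t| ≤
      M * (1 / 2) ^ k * Real.exp (2 * L * t) := by
  have hM0 : 0 ≤ M := (abs_nonneg _).trans (hM 0 (by simp))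
  induction k with
  | zero =>
    intro t ht
    refine (hM t ht).trans ?_
    rw [pow_zero, mul_one]
    exact le_mul_of_one_le_right hM0 (Real.one_le_exp (by have := ht.1; positivity))
  | succ k ih =>
    intro t ht
    have hint : ∀ j, IntervalIntegrable (fun s => f s (picard f y₀ j s)) volume 0 t := fun j =>
      intervalIntegrable_comp_of_bound hf hb hc
        (continuous_picard hf hb hc hy₀ j).measurable 0 t
    have hstep : picard f y₀ (k + 1 + 1) t - picard f y₀ (k + 1) t =
        ∫ s in (0 : ℝ)..t, (f s (picard f y₀ (k + 1) s) - f s (picard f y₀ k s)) :=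
      (intervalIntegral.integral_sub (hint (k + 1)) (hint k)).symm
    have hderiv : ∀ s ∈ Set.uIcc 0 t, HasDerivAt
        (fun s => M * (1 / 2) ^ (k + 1) * Real.exp (2 * L * s))
        (L * (M * (1 / 2) ^ k * Real.exp (2 * L * s))) s := by
      intro s _
      have h := (((hasDerivAt_id s).const_mul (2 * L)).exp).const_mul (M * (1 / 2) ^ (k + 1))
      refine h.congr_deriv ?_
      simp only [id]
      ring
    have hexpint : IntervalIntegrable
        (fun s => L * (M * (1 / 2) ^ k * Real.exp (2 * L * s))) volume 0 t := by
      apply Continuous.intervalIntegrable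
      fun_prop
    have hle : |∫ s in (0 : ℝ)..t, (f s (picard f y₀ (k + 1) s) - f s (picard f y₀ k s))| ≤
        ∫ s in (0 : ℝ)..t, L * (M * (1 / 2) ^ k * Real.exp (2 * L * s)) := by
      rw [← Real.norm_eq_abs]
      refine intervalIntegral.norm_integral_le_of_norm_le ht.1 ?_ hexpint
      refine Eventually.of_forall fun s hs => ?_
      rw [Real.norm_eq_abs]
      rcases le_total s δ with h | h
      · rw [picard_eq_initial hδ _ s hs.1.le h, picard_eq_initial hδ _ s hs.1.le h, sub_self,
          abs_zero]
        positivity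
      · exact (hlip s h (hs.2.trans ht.2) _ _).trans
          (mul_le_mul_of_nonneg_left (ih s ⟨hs.1.le, hs.2.trans ht.2⟩) hL.le)
    rw [hstep]
    refine hle.trans ?_
    rw [intervalIntegral.integral_eq_sub_of_hasDerivAt hderiv hexpint]
    have : 0 ≤ M * (1 / 2) ^ (k + 1) * Real.exp (2 * L * 0) := by positivity
    linarith

theorem exists_tendsto_picard (hf : Measurable (Function.uncurry f))
    (hb : ∀ s a, |f s a| ≤ |c s|) (hc : ∀ a b, IntervalIntegrable c volume a b)
    (hy₀ : Continuous y₀) {δ L : ℝ} (hL : 0 < L)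
    (hδ : ∀ t, 0 ≤ t → t ≤ δ → ∫ s in (0 : ℝ)..t, f s (y₀ s) = y₀ t)
    (hlip : ∀ s, δ ≤ s → s ≤ 1 → ∀ a a', |f s a - f s a'| ≤ L * |a - a'|) :
    ∃ y : ℝ → ℝ, Measurable y ∧
      (∀ t ∈ Set.Icc (0 : ℝ) 1, Tendsto (fun k => picard f y₀ k t) atTop (𝓝 (y t))) ∧
      (∀ t, 0 ≤ t → t ≤ δ → t ≤ 1 → y t = y₀ t) ∧
      ∀ t ∈ Set.Icc (0 : ℝ) 1, y t = ∫ s in (0 : ℝ)..t, f s (y s) := by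
  have hcont := continuous_picard hf hb hc hy₀
  obtain ⟨M, hM⟩ : ∃ M, ∀ t ∈ Set.Icc (0 : ℝ) 1, |picard f y₀ 1 t - y₀ t| ≤ M :=
    isCompact_Icc.exists_bound_of_continuousOn ((hcont 1).sub hy₀).continuousOn
  have hcauchy : ∀ t ∈ Set.Icc (0 : ℝ) 1, CauchySeq fun k => picard f y₀ k t := by
    intro t ht
    refine cauchySeq_of_le_geometric (1 / 2) (M * Real.exp (2 * L * t)) (by norm_num) fun k => ?_
    rw [dist_comm, Real.dist_eq]
    refine (abs_picard_succ_sub_le hf hb hc hy₀ hL hδ hlip hM k t ht).trans (le_of_eq ?_)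
    ring
  -- Convergence is known only on [0, 1]; clamping the time gives a limit that is defined and
  -- measurable on all of ℝ.
  have hproj : ∀ t : ℝ, max 0 (min t 1) ∈ Set.Icc (0 : ℝ) 1 := fun t =>
    ⟨le_max_left _ _, max_le zero_le_one (min_le_right _ _)⟩
  have hproj_eq : ∀ t ∈ Set.Icc (0 : ℝ) 1, max 0 (min t 1) = t := fun t ht => by
    rw [min_eq_left ht.2, max_eq_right ht.1]
  choose y hy using fun t : ℝ => cauchySeq_tendsto_of_complete (hcauchy _ (hproj t))
  have hymeas : Measurable y := by
    refine measurable_of_tendsto_metrizable (f := fun k t => picard f y₀ k (max 0 (min t 1)))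
      (fun k => ?_) (tendsto_pi_nhds.2 hy)
    exact (hcont k).measurable.comp (by fun_prop)
  have hy' : ∀ t ∈ Set.Icc (0 : ℝ) 1, Tendsto (fun k => picard f y₀ k t) atTop (𝓝 (y t)) := by
    intro t ht
    have := hy t
    rwa [hproj_eq t ht] at this
  have hyδ : ∀ t, 0 ≤ t → t ≤ δ → t ≤ 1 → y t = y₀ t := by
    intro t ht htδ ht1
    refine tendsto_nhds_unique (hy' t ⟨ht, ht1⟩) ?_
    simp only [picard_eq_initial hδ _ t ht htδ]
    exact tendsto_const_nhds
  refine ⟨y, hymeas, hy', hyδ, fun t ht => ?_⟩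
  refine tendsto_nhds_unique ((tendsto_add_atTop_iff_nat 1).2 (hy' t ht)) ?_
  refine intervalIntegral.tendsto_integral_filter_of_dominated_convergence (fun s => |c s|)
    (Eventually.of_forall fun k => ?_) (Eventually.of_forall fun k => ?_) (hc 0 t).abs ?_
  · exact (hf.comp (measurable_id.prodMk (hcont k).measurable)).aestronglyMeasurable
  · exact Eventually.of_forall fun s _ => hb s _
  · refine Eventually.of_forall fun s hs => ?_
    rw [Set.uIoc_of_le ht.1] at hs
    rcases le_total s δ with h | h
    · simp only [picard_eq_initial hδ _ s hs.1.le h, hyδ s hs.1.le h (hs.2.trans ht.2)]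
      exact tendsto_const_nhds
    · have h0 := (hy' s ⟨hs.1.le, hs.2.trans ht.2⟩).sub_const (y s)
      rw [sub_self] at h0
      have h1 := h0.abs.const_mul L
      rw [abs_zero, mul_zero] at h1
      exact tendsto_iff_norm_sub_tendsto_zero.2 (squeeze_zero (fun _ => norm_nonneg _)
        (fun k => hlip s h (hs.2.trans ht.2) _ _) h1)

/-- Picard iterates depend measurably on a parameter, and do so in a causal way. -/
lemma measurable_picard {Ω : Type*} [MeasurableSpace Ω] {f : Ω → ℝ → ℝ → ℝ} {T : ℝ}
    (hcont : ∀ ω k, Continuous (picard (f ω) y₀ k))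
    (hf : Measurable fun p : Ω × ℝ × ℝ => f p.1 (max 0 (min p.2.1 T)) p.2.2) (k : ℕ) :
    ∀ t, 0 ≤ t → t ≤ T → Measurable fun ω => picard (f ω) y₀ k t := by
  induction k with
  | zero => exact fun t _ _ => measurable_const
  | succ k ih =>
    intro t ht htT
    have hT : 0 ≤ T := ht.trans htT
    -- Clamping times to [0, T] is what encodes causality: only the values of `f` at times up to T
    -- need to be measurable in the parameter.
    have hu : Measurable (Function.uncurry
        fun (s : ℝ) (ω : Ω) => picard (f ω) y₀ k (max 0 (min s T))) := by
      refine measurable_uncurry_of_continuous_of_measurable (fun ω => ?_) fun s => ?_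
      · exact (hcont ω k).comp (by fun_prop)
      · exact ih _ (le_max_left _ _) (max_le hT (min_le_right _ _))
    have hg : Measurable fun p : Ω × ℝ =>
        f p.1 (max 0 (min p.2 T)) (picard (f p.1) y₀ k (max 0 (min p.2 T))) :=
      hf.comp (measurable_fst.prodMk (measurable_snd.prodMk (hu.comp measurable_swap)))
    have heq : (fun ω => picard (f ω) y₀ (k + 1) t) = fun ω => ∫ s in Set.Ioc 0 t,
        f ω (max 0 (min s T)) (picard (f ω) y₀ k (max 0 (min s T))) := by
      funext ω
      simp only [picard]
      rw [intervalIntegral.integral_of_le ht]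
      refine setIntegral_congr_fun measurableSet_Ioc fun s hs => ?_
      simp only [min_eq_left (hs.2.trans htT), max_eq_right hs.1.le]
    rw [heq]
    exact (StronglyMeasurable.integral_prod_right' (ν := volume.restrict (Set.Ioc 0 t))
      hg.stronglyMeasurable).measurable

end Picard

/-! ### The odd bump profile. -/

section Profile

variable {d : ℕ}

/-- The unit vector in the direction of the coordinate `i`. -/
noncomputable abbrev dir (i : Fin d) : Space d := EuclideanSpace.single i 1

lemma norm_dir (i : Fin d) : ‖dir i‖ = 1 := by simp

/-- A smooth bump centred at `c`, equal to `1` at distance at most `1/2` from `c`. -/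
noncomputable def bumpAt (c : Space d) : ContDiffBump c where
  rIn := 1 / 2
  rOut := 3 / 4
  rIn_pos := by norm_num
  rIn_lt_rOut := by norm_num

/-- A smooth compactly supported function, equal to `1` near `(3/4) e_i` and to `-1` near
`-(3/4) e_i`. -/
noncomputable def profile (i : Fin d) (x : Space d) : ℝ :=
  bumpAt ((3 / 4 : ℝ) • dir i) x - bumpAt (-((3 / 4 : ℝ) • dir i)) x

lemma contDiff_profile (i : Fin d) : ContDiff ℝ 1 (profile i) :=
  (bumpAt _).contDiff.sub (bumpAt _).contDiff

lemma continuous_profile (i : Fin d) : Continuous (profile i) := (contDiff_profile i).continuous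

lemma hasCompactSupport_profile (i : Fin d) : HasCompactSupport (profile i) :=
  (bumpAt _).hasCompactSupport.sub (bumpAt _).hasCompactSupport

lemma exists_lipschitzWith_profile (i : Fin d) : ∃ L, LipschitzWith L (profile i) :=
  (contDiff_profile i).lipschitzWith_of_hasCompactSupport (hasCompactSupport_profile i) one_ne_zero

lemma abs_profile_le_one (i : Fin d) (x : Space d) : |profile i x| ≤ 1 := by
  have h1 := (bumpAt ((3 / 4 : ℝ) • dir i)).nonneg (x := x)
  have h2 := (bumpAt ((3 / 4 : ℝ) • dir i)).le_one (x := x)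
  have h3 := (bumpAt (-((3 / 4 : ℝ) • dir i))).nonneg (x := x)
  have h4 := (bumpAt (-((3 / 4 : ℝ) • dir i))).le_one (x := x)
  rw [abs_le]
  unfold profile
  constructor <;> linarith

lemma integrable_profile (i : Fin d) : Integrable (profile i) volume :=
  (continuous_profile i).integrable_of_hasCompactSupport (hasCompactSupport_profile i)

lemma profile_eq_zero (i : Fin d) {x : Space d} (hx : 2 ≤ ‖x‖) : profile i x = 0 := by
  have hd : ‖(3 / 4 : ℝ) • dir i‖ = 3 / 4 := by rw [norm_smul, norm_dir]; norm_num
  unfold profile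
  rw [ContDiffBump.zero_of_le_dist, ContDiffBump.zero_of_le_dist, sub_zero]
  · change 3 / 4 ≤ _
    have := norm_sub_norm_le x (-((3 / 4 : ℝ) • dir i))
    rw [dist_eq_norm]
    rw [norm_neg, hd] at this
    linarith
  · change 3 / 4 ≤ _
    have := norm_sub_norm_le x ((3 / 4 : ℝ) • dir i)
    rw [dist_eq_norm]
    rw [hd] at this
    linarith

lemma profile_neg (i : Fin d) (x : Space d) : profile i (-x) = -profile i x := by
  have h : ∀ c y : Space d, bumpAt (-c) (-y) = bumpAt c y := by
    intro c y
    simp only [ContDiffBump.apply, bumpAt, neg_sub_neg]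
    rw [← (someContDiffBumpBase (Space d)).symmetric _ ((1 / 2 : ℝ)⁻¹ • (y - c)), ← smul_neg,
      neg_sub]
  unfold profile
  rw [h]
  have := h (-((3 / 4 : ℝ) • dir i)) x
  rw [neg_neg] at this
  rw [this]
  ring

/-- The centres of the two bumps are 3/2 apart, so such a point is at distance at least 1 from the
other centre, beyond the outer radius 3/4. -/
lemma profile_eq_one (i : Fin d) {x : Space d} (hx : ‖x - (3 / 4 : ℝ) • dir i‖ ≤ 1 / 2) :
    profile i x = 1 := by
  unfold profile
  rw [ContDiffBump.one_of_mem_closedBall, ContDiffBump.zero_of_le_dist, sub_zero]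
  · change 3 / 4 ≤ _
    have h : ‖(3 / 2 : ℝ) • dir i‖ = 3 / 2 := by rw [norm_smul, norm_dir]; norm_num
    have h2 := norm_sub_norm_le ((3 / 2 : ℝ) • dir i) (-(x - (3 / 4 : ℝ) • dir i))
    rw [dist_eq_norm]
    have h3 : (3 / 2 : ℝ) • dir i - -(x - (3 / 4 : ℝ) • dir i) =
        x - -((3 / 4 : ℝ) • dir i) := by module
    rw [h3, h, norm_neg] at h2
    linarith
  · rw [mem_closedBall_iff_norm]
    exact hx

/-- For `ε = ±1`, the profile is `ε` at the points that are close to `ε s e_i`, `s ∈ [1/2, 1]`. -/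
lemma profile_eq_sign (i : Fin d) {ε s : ℝ} (hε : ε = 1 ∨ ε = -1) (hs : s ∈ Set.Icc (1 / 2 : ℝ) 1)
    {x : Space d} (hx : ‖x - (ε * s) • dir i‖ ≤ 1 / 4) : profile i x = ε := by
  have key : ∀ x : Space d, ‖x - s • dir i‖ ≤ 1 / 4 → profile i x = 1 := by
    intro x hx
    apply profile_eq_one
    have h1 : x - (3 / 4 : ℝ) • dir i = (x - s • dir i) + (s - 3 / 4) • dir i := by module
    rw [h1]
    refine (norm_add_le _ _).trans ?_
    rw [norm_smul, norm_dir, Real.norm_eq_abs]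
    have : |s - 3 / 4| ≤ 1 / 4 := by rw [abs_le]; constructor <;> linarith [hs.1, hs.2]
    linarith
  rcases hε with rfl | rfl
  · exact key x (by rwa [one_mul] at hx)
  · rw [← neg_neg x, profile_neg, key]
    have h : -x - s • dir i = -(x - (-1 * s) • dir i) := by module
    rwa [h, norm_neg]

end Profile

/-! ### Littlewood-Paley kernels and their scaling. -/

section Kernel

variable {d : ℕ}

lemma contDiff_dyadicSymbol (n : ℕ) : ContDiff ℝ ((⊤ : ℕ∞) : WithTop ℕ∞) (dyadicSymbol d n) := by
  cases n with
  | zero => exact (cutoff d).contDiff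
  | succ j =>
    exact ((cutoff d).contDiff.comp (contDiff_const_smul _)).sub
      ((cutoff d).contDiff.comp (contDiff_const_smul _))

lemma hasCompactSupport_dyadicSymbol (n : ℕ) : HasCompactSupport (dyadicSymbol d n) := by
  cases n with
  | zero => exact (cutoff d).hasCompactSupport
  | succ j =>
    exact ((cutoff d).hasCompactSupport.comp_smul (by positivity)).sub
      ((cutoff d).hasCompactSupport.comp_smul (by positivity))

/-- The dyadic kernels are real parts of Schwartz functions. -/
lemma exists_schwartzMap_dyadicKernel (d n : ℕ) : ∃ φ : SchwartzMap (Space d) ℂ,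
    (∀ x, dyadicKernel d n x = (φ x).re) ∧ ∫ x, φ x = dyadicSymbol d n 0 := by
  have hsupp : HasCompactSupport fun ξ : Space d => (dyadicSymbol d n ξ : ℂ) :=
    (hasCompactSupport_dyadicSymbol n).comp_left (g := fun r : ℝ => (r : ℂ)) Complex.ofReal_zero
  have hsmooth : ContDiff ℝ ((⊤ : ℕ∞) : WithTop ℕ∞) fun ξ : Space d => (dyadicSymbol d n ξ : ℂ) :=
    Complex.ofRealCLM.contDiff.comp (contDiff_dyadicSymbol n)
  refine ⟨𝓕⁻ (hsupp.toSchwartzMap hsmooth), fun x => ?_, ?_⟩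
  · rw [SchwartzMap.fourierInv_coe]
    rfl
  -- The integral of a function is its Fourier transform at 0, so Fourier inversion evaluated at 0
  -- gives the claim.
  · have h : 𝓕 (𝓕⁻ (hsupp.toSchwartzMap hsmooth)) = hsupp.toSchwartzMap hsmooth :=
      FourierTransform.fourier_fourierInv_eq _
    have h0 := congrArg (fun ψ : SchwartzMap (Space d) ℂ => ψ 0) h
    simp only [SchwartzMap.fourier_coe, Real.fourier_eq] at h0
    simpa using h0

lemma continuous_dyadicKernel (d n : ℕ) : Continuous (dyadicKernel d n) := by
  obtain ⟨φ, hφ, -⟩ := exists_schwartzMap_dyadicKernel d n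
  rw [funext hφ]
  exact Complex.continuous_re.comp φ.continuous

lemma integrable_dyadicKernel (d n : ℕ) : Integrable (dyadicKernel d n) volume := by
  obtain ⟨φ, hφ, -⟩ := exists_schwartzMap_dyadicKernel d n
  rw [funext hφ]
  exact φ.integrable.re

lemma integrable_norm_mul_dyadicKernel (d n : ℕ) :
    Integrable (fun x => ‖x‖ * |dyadicKernel d n x|) volume := by
  obtain ⟨φ, hφ, -⟩ := exists_schwartzMap_dyadicKernel d n
  refine (φ.integrable_pow_mul volume 1).mono
    (continuous_norm.mul (continuous_dyadicKernel d n).abs).aestronglyMeasurable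
    (Eventually.of_forall fun x => ?_)
  simp only [norm_mul, pow_one, Real.norm_eq_abs, abs_abs, abs_norm, hφ]
  exact mul_le_mul_of_nonneg_left (Complex.abs_re_le_norm _) (norm_nonneg _)

lemma exists_abs_dyadicKernel_le (d n : ℕ) : ∃ C, ∀ x, |dyadicKernel d n x| ≤ C := by
  obtain ⟨φ, hφ, -⟩ := exists_schwartzMap_dyadicKernel d n
  obtain ⟨C, -, hC⟩ := φ.decay 0 0
  refine ⟨C, fun x => ?_⟩
  rw [hφ]
  exact (Complex.abs_re_le_norm _).trans (by simpa using hC x)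

lemma integral_dyadicKernel (d n : ℕ) : ∫ x, dyadicKernel d n x = dyadicSymbol d n 0 := by
  obtain ⟨φ, hφ, h0⟩ := exists_schwartzMap_dyadicKernel d n
  simp_rw [hφ]
  have := integral_re (𝕜 := ℂ) (φ.integrable (μ := volume))
  simp only [RCLike.re_eq_complex_re] at this
  rw [this, h0, Complex.ofReal_re]

/-- The two cutoffs in the annular symbol cancel at the origin. This cancellation yields the decay
of the high-frequency blocks. -/
lemma integral_dyadicKernel_one (d : ℕ) : ∫ x, dyadicKernel d 1 x = 0 := by
  rw [integral_dyadicKernel]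
  simp [dyadicSymbol]

lemma dyadicSymbol_succ (j : ℕ) (ξ : Space d) :
    dyadicSymbol d (j + 1) ξ = dyadicSymbol d 1 (((2 : ℝ) ^ j)⁻¹ • ξ) := by
  simp only [dyadicSymbol, smul_smul]
  congr 3
  · rw [pow_add, mul_inv, mul_comm]
  · norm_num

lemma dyadicKernel_succ (j : ℕ) (x : Space d) :
    dyadicKernel d (j + 1) x = ((2 : ℝ) ^ j) ^ d * dyadicKernel d 1 ((2 : ℝ) ^ j • x) := by
  have h2 : (2 : ℝ) ^ j ≠ 0 := by positivity
  unfold dyadicKernel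
  rw [← Complex.re_ofReal_mul]
  congr 1
  rw [Real.fourierInv_eq, Real.fourierInv_eq]
  simp_rw [dyadicSymbol_succ j]
  have := Measure.integral_comp_inv_smul (volume : Measure (Space d))
    (fun v => Real.fourierChar (inner ℝ v ((2 : ℝ) ^ j • x)) • (dyadicSymbol d 1 v : ℂ))
    ((2 : ℝ) ^ j)
  rw [finrank_euclideanSpace_fin, abs_of_pos (by positivity)] at this
  rw [← Complex.real_smul, ← this]
  refine integral_congr_ae (Eventually.of_forall fun v => ?_)
  simp only [inner_smul_left, inner_smul_right, RCLike.conj_to_real, mul_inv_cancel_left₀ h2]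

/-- The Littlewood-Paley blocks as convolutions at unit scale. -/
lemma dyadicBlock_zero (f : Space d → Space d) (x : Space d) :
    dyadicBlock 0 f x = ∫ z, dyadicKernel d 0 z • f (x - z) := by
  unfold dyadicBlock
  rw [← integral_sub_left_eq_self (fun z => dyadicKernel d 0 z • f (x - z)) volume x]
  simp

lemma dyadicBlock_succ (j : ℕ) (f : Space d → Space d) (x : Space d) :
    dyadicBlock (j + 1) f x = ∫ z, dyadicKernel d 1 z • f (x - ((2 : ℝ) ^ j)⁻¹ • z) := by
  have h2 : (2 : ℝ) ^ j ≠ 0 := by positivity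
  have h := Measure.integral_comp_smul (volume : Measure (Space d))
    (fun z => dyadicKernel d 1 z • f (x - ((2 : ℝ) ^ j)⁻¹ • z)) ((2 : ℝ) ^ j)
  rw [finrank_euclideanSpace_fin, abs_of_pos (by positivity)] at h
  rw [← inv_smul_eq_iff₀ (by positivity), inv_inv] at h
  unfold dyadicBlock
  rw [← h, ← integral_smul,
    ← integral_sub_left_eq_self (fun z => ((2 : ℝ) ^ j) ^ d • _) volume x]
  refine integral_congr_ae (Eventually.of_forall fun y => ?_)
  simp only [dyadicKernel_succ j, smul_smul, inv_mul_cancel₀ h2, one_smul, sub_sub_cancel]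

end Kernel

/-! ### Three bounds for a convolution at relative scale ρ. -/

section Convolution

variable {d : ℕ} {k g : Space d → ℝ}

lemma abs_integral_mul_le_integral (hk : Integrable k volume) (hg : ∀ x, |g x| ≤ 1)
    (φ : Space d → Space d) : |∫ z, k z * g (φ z)| ≤ ∫ z, |k z| := by
  rw [← Real.norm_eq_abs]
  refine norm_integral_le_of_norm_le hk.abs (Eventually.of_forall fun z => ?_)
  rw [norm_mul, Real.norm_eq_abs, Real.norm_eq_abs]
  exact mul_le_of_le_one_right (abs_nonneg _) (hg _)

/-- Useful for small ρ: the kernel is bounded, and the change of variables produces the Jacobian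
ρ^d. -/
lemma abs_integral_mul_le_pow {C : ℝ} (hk : ∀ x, |k x| ≤ C) (hg : Integrable g volume) {ρ : ℝ}
    (hρ : 0 < ρ) (y : Space d) :
    |∫ z, k z * g (y - ρ⁻¹ • z)| ≤ C * (ρ ^ d * ∫ z, |g z|) := by
  have h1 : Integrable (fun z : Space d => |g (y - ρ⁻¹ • z)|) volume :=
    ((hg.comp_sub_left y).comp_smul (inv_ne_zero hρ.ne')).abs
  have h2 : ∫ z : Space d, |g (y - ρ⁻¹ • z)| = ρ ^ d * ∫ z, |g z| := by
    rw [Measure.integral_comp_inv_smul (volume : Measure (Space d)) (fun z => |g (y - z)|) ρ,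
      finrank_euclideanSpace_fin, abs_of_pos (by positivity), smul_eq_mul,
      integral_sub_left_eq_self (fun z => |g z|) volume y]
  rw [← Real.norm_eq_abs, ← h2, ← integral_const_mul]
  refine norm_integral_le_of_norm_le (h1.const_mul C) (Eventually.of_forall fun z => ?_)
  rw [norm_mul, Real.norm_eq_abs, Real.norm_eq_abs]
  exact mul_le_mul_of_nonneg_right (hk z) (abs_nonneg _)

/-- Useful for large ρ: since `k` has mean zero, `g y` may be subtracted from the integrand, and the
Lipschitz bound then gains ρ⁻¹‖z‖. -/
lemma abs_integral_mul_le_inv {L : ℝ≥0} (hk : Integrable k volume)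
    (hk' : Integrable (fun x => ‖x‖ * |k x|) volume) (hk0 : ∫ z, k z = 0)
    (hgb : ∀ x, |g x| ≤ 1) (hg : LipschitzWith L g) {ρ : ℝ} (hρ : 0 < ρ) (y : Space d) :
    |∫ z, k z * g (y - ρ⁻¹ • z)| ≤ L * ρ⁻¹ * ∫ z, ‖z‖ * |k z| := by
  have hint : Integrable (fun z => k z * g (y - ρ⁻¹ • z)) volume :=
    hk.mul_bdd (c := 1) (hg.continuous.comp (by fun_prop)).aestronglyMeasurable
      (Eventually.of_forall fun z => hgb _)
  have h1 : ∫ z, k z * g (y - ρ⁻¹ • z) = ∫ z, k z * (g (y - ρ⁻¹ • z) - g y) := by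
    simp_rw [mul_sub]
    rw [integral_sub hint (hk.mul_const _), integral_mul_const, hk0]
    simp
  rw [h1, ← Real.norm_eq_abs, ← integral_const_mul]
  refine norm_integral_le_of_norm_le (hk'.const_mul _) (Eventually.of_forall fun z => ?_)
  rw [norm_mul, Real.norm_eq_abs]
  have h2 := hg.dist_le_mul (y - ρ⁻¹ • z) y
  rw [dist_eq_norm, dist_eq_norm, sub_sub_cancel_left, norm_neg, norm_smul, norm_inv,
    Real.norm_of_nonneg hρ.le] at h2
  calc |k z| * ‖g (y - ρ⁻¹ • z) - g y‖ ≤ |k z| * (L * (ρ⁻¹ * ‖z‖)) :=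
        mul_le_mul_of_nonneg_left h2 (abs_nonneg _)
    _ = L * ρ⁻¹ * (‖z‖ * |k z|) := by ring

end Convolution

/-! ### Lebesgue and Besov norms of the rescaled profile. -/

section ScaledProfile

variable {d : ℕ}

/-- The profile at scale `lam`, with amplitude `a`. -/
noncomputable def scaledProfile (i : Fin d) (a lam : ℝ) (x : Space d) : Space d :=
  (a * profile i (lam⁻¹ • x)) • dir i

lemma continuous_scaledProfile (i : Fin d) (a lam : ℝ) : Continuous (scaledProfile i a lam) :=
  (continuous_const.mul ((continuous_profile i).comp (continuous_const_smul _))).smul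
    continuous_const

/-- Linearity in the amplitude at a fixed scale reduces Bochner measurability of the drift to
approximating a real number. -/
lemma scaledProfile_sub (i : Fin d) (a a' lam : ℝ) :
    (fun x => scaledProfile i a lam x - scaledProfile i a' lam x) =
      scaledProfile i (a - a') lam := by
  funext x
  simp only [scaledProfile, ← sub_smul, sub_mul]

lemma norm_scaledProfile_le (i : Fin d) (a lam : ℝ) (x : Space d) :
    ‖scaledProfile i a lam x‖ ≤ |a| := by
  rw [scaledProfile, norm_smul, norm_dir, mul_one, Real.norm_eq_abs, abs_mul]
  exact mul_le_of_le_one_right (abs_nonneg _) (abs_profile_le_one _ _)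

lemma scaledProfile_eq_zero (i : Fin d) (a : ℝ) {lam : ℝ} (hlam : 0 < lam) {x : Space d}
    (hx : 2 * lam ≤ ‖x‖) : scaledProfile i a lam x = 0 := by
  rw [scaledProfile, profile_eq_zero, mul_zero, zero_smul]
  rw [norm_smul, norm_inv, Real.norm_of_nonneg hlam.le, inv_mul_eq_div, le_div_iff₀ hlam]
  exact hx

lemma hasCompactSupport_scaledProfile (i : Fin d) (a : ℝ) {lam : ℝ} (hlam : 0 < lam) :
    HasCompactSupport (scaledProfile i a lam) :=
  HasCompactSupport.intro (isCompact_closedBall 0 (2 * lam)) fun x hx =>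
    scaledProfile_eq_zero i a hlam (by simpa using (not_le.1 (fun h => hx (by simpa using h))).le)

lemma isTempered_scaledProfile (i : Fin d) (a : ℝ) {lam : ℝ} (hlam : 0 < lam) :
    IsTempered (scaledProfile i a lam) := by
  refine ⟨(continuous_scaledProfile i a lam).aestronglyMeasurable, 0, ?_⟩
  simpa using (continuous_scaledProfile i a lam).integrable_of_hasCompactSupport
    (hasCompactSupport_scaledProfile i a hlam)

lemma eLpNorm_top_scaledProfile_le (i : Fin d) (a lam : ℝ) :
    eLpNorm (scaledProfile i a lam) ∞ volume ≤ ENNReal.ofReal |a| := by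
  rw [eLpNorm_exponent_top]
  exact eLpNormEssSup_le_of_ae_bound (Eventually.of_forall (norm_scaledProfile_le i a lam))

lemma memLp_scaledProfile (i : Fin d) (a : ℝ) {lam : ℝ} (hlam : 0 < lam) (p : ℝ≥0∞) :
    MemLp (scaledProfile i a lam) p volume :=
  (continuous_scaledProfile i a lam).memLp_of_hasCompactSupport
    (hasCompactSupport_scaledProfile i a hlam)

/-- The function is bounded by |a| and supported in a ball of radius 2 lam, of volume proportional
to lam^d. -/
lemma exists_eLpNorm_scaledProfile_le (i : Fin d) (p : ℝ≥0∞) : ∃ C, 0 ≤ C ∧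
    ∀ a lam : ℝ, 0 < lam → eLpNorm (scaledProfile i a lam) p volume ≤
      ENNReal.ofReal (C * |a| * lam ^ (d * p⁻¹.toReal)) := by
  set V : ℝ := (volume (Metric.ball (0 : Space d) 1)).toReal with hV
  refine ⟨(2 ^ d * V) ^ p⁻¹.toReal, by positivity, fun a lam hlam => ?_⟩
  have hsupp : Function.support (scaledProfile i a lam) ⊆ Metric.ball 0 (2 * lam) := by
    intro x hx
    by_contra h
    exact hx (scaledProfile_eq_zero i a hlam (by simpa using h))
  have hvol : volume (Metric.ball (0 : Space d) (2 * lam)) =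
      ENNReal.ofReal (2 ^ d * V * lam ^ d) := by
    rw [Measure.addHaar_ball_of_pos _ _ (by positivity), finrank_euclideanSpace_fin,
      ← ENNReal.ofReal_toReal (a := volume (Metric.ball (0 : Space d) 1))
        Metric.isBounded_ball.measure_lt_top.ne, ← hV, ← ENNReal.ofReal_mul (by positivity)]
    congr 1
    ring
  rw [← eLpNorm_restrict_eq_of_support_subset hsupp]
  refine (eLpNorm_le_of_ae_bound
    (Eventually.of_forall (norm_scaledProfile_le i a lam))).trans (le_of_eq ?_)
  rw [Measure.restrict_apply_univ, hvol, ← ENNReal.toReal_inv,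
    ENNReal.ofReal_rpow_of_nonneg (by positivity) ENNReal.toReal_nonneg,
    ← ENNReal.ofReal_mul (by positivity)]
  congr 1
  rw [Real.mul_rpow (by positivity) (by positivity), Real.rpow_mul hlam.le, Real.rpow_natCast]
  ring

lemma dyadicBlock_zero_scaledProfile (i : Fin d) (a lam : ℝ) (x : Space d) :
    dyadicBlock 0 (scaledProfile i a lam) x =
      (a * ∫ z, dyadicKernel d 0 z * profile i (lam⁻¹ • x - lam⁻¹ • z)) • dir i := by
  rw [dyadicBlock_zero, ← integral_const_mul, ← integral_smul_const]
  refine integral_congr_ae (Eventually.of_forall fun z => ?_)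
  simp only [scaledProfile, smul_smul, smul_sub]
  congr 1
  ring

lemma dyadicBlock_succ_scaledProfile (i : Fin d) (a lam : ℝ) (j : ℕ) (x : Space d) :
    dyadicBlock (j + 1) (scaledProfile i a lam) x =
      (a * ∫ z, dyadicKernel d 1 z * profile i (lam⁻¹ • x - ((2 : ℝ) ^ j * lam)⁻¹ • z)) •
        dir i := by
  rw [dyadicBlock_succ, ← integral_const_mul, ← integral_smul_const]
  refine integral_congr_ae (Eventually.of_forall fun z => ?_)
  simp only [scaledProfile, smul_smul, smul_sub, mul_inv, mul_comm lam⁻¹]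
  congr 1
  ring

/-- After rescaling, a block depends on the scale only through r = 2^j lam. The bounds 1, r^d and
r⁻¹ come from boundedness, integrability and the Lipschitz property of the profile; the
low-frequency kernel has no cancellation, so r⁻¹ is missing there. -/
lemma exists_dyadicBlock_scaledProfile_le (i : Fin d) : ∃ C, 0 ≤ C ∧ ∀ a lam : ℝ, 0 < lam →
    (∀ x, ‖dyadicBlock 0 (scaledProfile i a lam) x‖ ≤ C * |a| * min 1 (lam ^ d)) ∧
    ∀ j x, ‖dyadicBlock (j + 1) (scaledProfile i a lam) x‖ ≤
      C * |a| * min 1 (min (((2 : ℝ) ^ j * lam) ^ d) ((2 : ℝ) ^ j * lam)⁻¹) := by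
  obtain ⟨L, hL⟩ := exists_lipschitzWith_profile i
  obtain ⟨C0, hC0⟩ := exists_abs_dyadicKernel_le d 0
  obtain ⟨C1, hC1⟩ := exists_abs_dyadicKernel_le d 1
  have hC0' : 0 ≤ C0 := (abs_nonneg _).trans (hC0 0)
  have hC1' : 0 ≤ C1 := (abs_nonneg _).trans (hC1 0)
  set G := ∫ z, |profile i z| with hG
  set A0 := ∫ z, |dyadicKernel d 0 z| with hA0
  set A1 := ∫ z, |dyadicKernel d 1 z| with hA1
  set D := ∫ z, ‖z‖ * |dyadicKernel d 1 z| with hD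
  have hG' : 0 ≤ G := integral_nonneg fun _ => abs_nonneg _
  have hA0' : 0 ≤ A0 := integral_nonneg fun _ => abs_nonneg _
  have hA1' : 0 ≤ A1 := integral_nonneg fun _ => abs_nonneg _
  have hD' : 0 ≤ D := integral_nonneg fun _ => by positivity
  have hCG0 : 0 ≤ C0 * G := by positivity
  have hCG1 : 0 ≤ C1 * G := by positivity
  have hLD : 0 ≤ L * D := by positivity
  have hnorm : ∀ a b : ℝ, ‖(a * b) • dir i‖ = |a| * |b| := fun a b => by
    rw [norm_smul, norm_dir, mul_one, Real.norm_eq_abs, abs_mul]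
  set C := C0 * G + C1 * G + A0 + A1 + L * D with hC
  have hCnn : 0 ≤ C := by positivity
  refine ⟨C, hCnn, fun a lam hlam => ⟨fun x => ?_, fun j x => ?_⟩⟩
  · rw [dyadicBlock_zero_scaledProfile, hnorm, mul_comm C, mul_assoc]
    refine mul_le_mul_of_nonneg_left ?_ (abs_nonneg a)
    rw [mul_min_of_nonneg _ _ hCnn, mul_one]
    refine le_min ?_ ?_
    · have := abs_integral_mul_le_integral (integrable_dyadicKernel d 0) (abs_profile_le_one i)
        (fun z => lam⁻¹ • x - lam⁻¹ • z)
      linarith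
    · have := abs_integral_mul_le_pow hC0 (integrable_profile i) hlam (lam⁻¹ • x)
      refine this.trans ?_
      rw [mul_left_comm, mul_comm]
      exact mul_le_mul_of_nonneg_right (by linarith) (by positivity)
  · rw [dyadicBlock_succ_scaledProfile, hnorm, mul_comm C, mul_assoc]
    have hr : 0 < (2 : ℝ) ^ j * lam := by positivity
    set r := (2 : ℝ) ^ j * lam with hr'
    refine mul_le_mul_of_nonneg_left ?_ (abs_nonneg a)
    rw [mul_min_of_nonneg _ _ hCnn, mul_min_of_nonneg _ _ hCnn, mul_one]
    refine le_min ?_ (le_min ?_ ?_)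
    · have := abs_integral_mul_le_integral (integrable_dyadicKernel d 1) (abs_profile_le_one i)
        (fun z => lam⁻¹ • x - r⁻¹ • z)
      linarith
    · have := abs_integral_mul_le_pow hC1 (integrable_profile i) hr (lam⁻¹ • x)
      refine this.trans ?_
      rw [mul_left_comm, mul_comm]
      exact mul_le_mul_of_nonneg_right (by linarith) (by positivity)
    · have := abs_integral_mul_le_inv (integrable_dyadicKernel d 1)
        (integrable_norm_mul_dyadicKernel d 1) (integral_dyadicKernel_one d)
        (abs_profile_le_one i) hL hr (lam⁻¹ • x)
      refine this.trans ?_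
      rw [mul_right_comm]
      exact mul_le_mul_of_nonneg_right (by linarith) (by positivity)

lemma min_one_pow_le_rpow_neg (hd : 1 ≤ d) {α r : ℝ} (hα : -1 < α) (hr : 0 < r) (hr1 : r ≤ 1) :
    min 1 (r ^ d) ≤ r ^ (-α) := by
  rcases le_total 0 α with h | h
  · exact (min_le_left _ _).trans
      (Real.one_le_rpow_of_pos_of_le_one_of_nonpos hr hr1 (by linarith))
  · refine (min_le_right _ _).trans ((pow_le_of_le_one hr.le hr1 (by lia)).trans ?_)
    simpa using Real.rpow_le_rpow_of_exponent_ge hr hr1 (show -α ≤ 1 by linarith)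

/-- The range of α enters here: decay r⁻¹ at high frequency suffices because α < 1, and r^d ≤ r at
low frequency suffices because α > -1. -/
lemma min_one_min_pow_inv_le_rpow_neg (hd : 1 ≤ d) {α r : ℝ} (hα : -1 < α) (hα1 : α < 1)
    (hr : 0 < r) : min 1 (min (r ^ d) r⁻¹) ≤ r ^ (-α) := by
  rcases le_total r 1 with hr1 | hr1
  · exact (min_le_min_left _ (min_le_left _ _)).trans (min_one_pow_le_rpow_neg hd hα hr hr1)
  · rcases le_total 0 α with h | h
    · refine (min_le_right _ _).trans ((min_le_right _ _).trans ?_)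
      rw [← Real.rpow_neg_one]
      exact Real.rpow_le_rpow_of_exponent_le hr1 (by linarith)
    · exact (min_le_left _ _).trans (Real.one_le_rpow hr1 (by linarith))

/-- The weight 2^(jα) times (2^j lam)^(-α) equals lam^(-α) for every j, so the supremum over blocks
costs nothing. -/
lemma exists_besovNorm_scaledProfile_le (hd : 1 ≤ d) (i : Fin d) {α : ℝ} (hα : -1 < α)
    (hα1 : α < 1) : ∃ C, 0 ≤ C ∧ ∀ a lam : ℝ, 0 < lam → lam ≤ 1 →
      besovNorm α (scaledProfile i a lam) ≤ ENNReal.ofReal (C * |a| * lam ^ (-α)) := by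
  obtain ⟨C, hC, hblock⟩ := exists_dyadicBlock_scaledProfile_le i
  refine ⟨2 * C, by positivity, fun a lam hlam hlam1 => iSup_le fun n => ?_⟩
  have key : ∀ w M : ℝ, 0 ≤ w → (∀ x, ‖dyadicBlock n (scaledProfile i a lam) x‖ ≤ M) →
      w * M ≤ 2 * C * |a| * lam ^ (-α) →
      ENNReal.ofReal w * eLpNorm (dyadicBlock n (scaledProfile i a lam)) ∞ volume ≤
        ENNReal.ofReal (2 * C * |a| * lam ^ (-α)) := by
    intro w M hw hM hwM
    have : eLpNorm (dyadicBlock n (scaledProfile i a lam)) ∞ volume ≤ ENNReal.ofReal M := by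
      rw [eLpNorm_exponent_top]
      exact eLpNormEssSup_le_of_ae_bound (Eventually.of_forall hM)
    refine (mul_le_mul_right this _).trans ?_
    rw [← ENNReal.ofReal_mul hw]
    exact ENNReal.ofReal_le_ofReal hwM
  cases n with
  | zero =>
    refine key _ _ (by positivity) (hblock a lam hlam).1 ?_
    -- The low-frequency block carries the weight 2^(-α), which accounts for the factor 2 in the
    -- constant.
    have h2 : (2 : ℝ) ^ ((((0 : ℕ) : ℝ) - 1) * α) ≤ 2 := by
      have := Real.rpow_le_rpow_of_exponent_le one_le_two
        (show (((0 : ℕ) : ℝ) - 1) * α ≤ 1 by push_cast; linarith)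
      rwa [Real.rpow_one] at this
    have h3 := min_one_pow_le_rpow_neg hd hα hlam hlam1
    calc _ ≤ 2 * (C * |a| * lam ^ (-α)) := by gcongr
      _ = _ := by ring
  | succ j =>
    refine key _ _ (by positivity) ((hblock a lam hlam).2 j) ?_
    have hr : 0 < (2 : ℝ) ^ j * lam := by positivity
    have h3 := min_one_min_pow_inv_le_rpow_neg hd hα hα1 hr
    have h4 : (2 : ℝ) ^ ((((j + 1 : ℕ) : ℝ) - 1) * α) * ((2 : ℝ) ^ j * lam) ^ (-α) =
        lam ^ (-α) := by
      rw [Real.mul_rpow (by positivity) hlam.le, ← Real.rpow_natCast, ← Real.rpow_mul zero_le_two,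
        ← mul_assoc, ← Real.rpow_add two_pos]
      push_cast
      ring_nf
      simp
    calc _ ≤ (2 : ℝ) ^ ((((j + 1 : ℕ) : ℝ) - 1) * α) *
          (C * |a| * ((2 : ℝ) ^ j * lam) ^ (-α)) := by gcongr
      _ = C * |a| * lam ^ (-α) := by rw [← h4]; ring
      _ ≤ 2 * (C * |a| * lam ^ (-α)) := by
        have : 0 ≤ C * |a| * lam ^ (-α) := by positivity
        linarith
      _ = _ := by ring

lemma exists_holderNorm_scaledProfile_le (hd : 1 ≤ d) (i : Fin d) {α : ℝ} (hα : -1 < α)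
    (hα1 : α < 1) : ∃ C, 0 ≤ C ∧ ∀ a lam : ℝ, 0 < lam → lam ≤ 1 →
      holderNorm α (scaledProfile i a lam) ≤ ENNReal.ofReal (C * |a| * lam ^ (-α)) := by
  by_cases h0 : α = 0
  · refine ⟨1, zero_le_one, fun a lam _ _ => ?_⟩
    simpa [holderNorm, h0] using eLpNorm_top_scaledProfile_le i a lam
  · simpa only [holderNorm, if_neg h0] using exists_besovNorm_scaledProfile_le hd i hα hα1

end ScaledProfile

/-! ### Integration over the unit interval as a subtype. -/

section UnitInterval

lemma ae_unitInterval_pos : ∀ᵐ t : I, 0 < (t : ℝ) := by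
  have h : ∀ᵐ x : ℝ ∂(volume.restrict (Set.Icc (0 : ℝ) 1)), 0 < x := by
    rw [← restrict_Ioc_eq_restrict_Icc]
    exact (ae_restrict_mem measurableSet_Ioc).mono fun x hx => hx.1
  exact unitInterval.measurePreserving_coe.quasiMeasurePreserving.ae h

lemma map_restrict_Iic_unitInterval (t : I) :
    Measure.map ((↑) : I → ℝ) (volume.restrict (Set.Iic t)) =
      volume.restrict (Set.Icc (0 : ℝ) t) := by
  have h1 : (Set.Iic t : Set I) = ((↑) : I → ℝ) ⁻¹' Set.Iic (t : ℝ) := by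
    ext s
    simp
  rw [h1, ← Measure.restrict_map measurable_subtype_coe measurableSet_Iic,
    unitInterval.measurePreserving_coe.map_eq, Measure.restrict_restrict measurableSet_Iic]
  congr 1
  ext s
  simp only [Set.mem_inter_iff, Set.mem_Iic, Set.mem_Icc]
  exact ⟨fun h => ⟨h.2.1, h.1⟩, fun h => ⟨h.2, h.1, h.2.trans t.2.2⟩⟩

lemma setIntegral_Iic_unitInterval {E : Type*} [NormedAddCommGroup E] [NormedSpace ℝ E] (f : ℝ → E)
    (t : I) :
    ∫ s in Set.Iic t, f s = ∫ s in (0 : ℝ)..t, f s := by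
  rw [← unitInterval.measurableEmbedding_coe.integral_map, map_restrict_Iic_unitInterval,
    intervalIntegral.integral_of_le t.2.1, integral_Icc_eq_integral_Ioc]

lemma integrableOn_Iic_unitInterval {E : Type*} [NormedAddCommGroup E] {f : ℝ → E} {t : I}
    (hf : IntervalIntegrable f volume 0 t) :
    IntegrableOn (fun s : I => f s) (Set.Iic t) volume := by
  change Integrable (f ∘ ((↑) : I → ℝ)) _
  rw [← unitInterval.measurableEmbedding_coe.integrable_map_iff, map_restrict_Iic_unitInterval,
    ← restrict_Ioc_eq_restrict_Icc]
  exact (intervalIntegrable_iff_integrableOn_Ioc_of_le t.2.1).1 hf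

lemma memLp_rpow_unitInterval {q : ℝ≥0∞} (hq : 1 ≤ q) {β : ℝ} (hβ : -(q⁻¹).toReal < β) :
    MemLp (fun t : I => (t : ℝ) ^ β) q volume := by
  have hmeas : AEStronglyMeasurable (fun t : I => (t : ℝ) ^ β) volume :=
    (measurable_subtype_coe.pow_const β).aestronglyMeasurable
  rcases eq_or_ne q ∞ with rfl | hq'
  · simp only [ENNReal.inv_top, ENNReal.toReal_zero, neg_zero] at hβ
    refine memLp_top_of_bound hmeas 1 (Eventually.of_forall fun t => ?_)
    rw [Real.norm_of_nonneg (Real.rpow_nonneg t.2.1 _)]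
    exact Real.rpow_le_one t.2.1 t.2.2 hβ.le
  · have hq0 : q ≠ 0 := (zero_lt_one.trans_le hq).ne'
    have hqr : 0 < q.toReal := ENNReal.toReal_pos hq0 hq'
    rw [← integrable_norm_rpow_iff hmeas hq0 hq']
    have h : IntervalIntegrable (fun x : ℝ => x ^ (β * q.toReal)) volume 0 1 := by
      apply intervalIntegral.intervalIntegrable_rpow'
      rw [ENNReal.toReal_inv] at hβ
      have := mul_lt_mul_of_pos_right hβ hqr
      rwa [neg_mul, inv_mul_cancel₀ hqr.ne'] at this
    have h2 := integrableOn_Iic_unitInterval (t := (1 : I)) (by simpa using h)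
    have h3 : (Set.Iic (1 : I)) = Set.univ := Set.Iic_top
    rw [h3, integrableOn_univ] at h2
    refine h2.congr (Eventually.of_forall fun t => ?_)
    simp only
    rw [Real.norm_of_nonneg (Real.rpow_nonneg t.2.1 _), Real.rpow_mul t.2.1]

end UnitInterval

/-! ### The repulsive drift and its space-time integrability. -/

section Drift

variable {d : ℕ}

/-- The integer `k` such that `t` belongs to the dyadic interval `(2 ^ (-k - 1), 2 ^ (-k)]`. -/
noncomputable def dyadicLevel (t : ℝ) : ℕ := Nat.log 2 ⌊t⁻¹⌋₊

lemma measurable_dyadicLevel : Measurable dyadicLevel :=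
  (measurable_of_countable (Nat.log 2)).comp (Nat.measurable_floor.comp measurable_inv)

/-- A piecewise constant version of `t ^ γ`. -/
noncomputable def levelScale (γ : ℝ) (k : ℕ) : ℝ := (2 : ℝ) ^ (-(k * γ))

lemma levelScale_pos (γ : ℝ) (k : ℕ) : 0 < levelScale γ k := by unfold levelScale; positivity

lemma levelScale_le_one {γ : ℝ} (hγ : 0 ≤ γ) (k : ℕ) : levelScale γ k ≤ 1 :=
  Real.rpow_le_one_of_one_le_of_nonpos one_le_two (neg_nonpos.2 (by positivity))

lemma levelScale_eq (γ : ℝ) (k : ℕ) : levelScale γ k = (((2 : ℝ) ^ k)⁻¹) ^ γ := by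
  rw [levelScale, Real.rpow_neg zero_le_two, Real.rpow_mul zero_le_two, Real.rpow_natCast,
    Real.inv_rpow (by positivity)]

lemma rpow_le_levelScale {γ : ℝ} (hγ : 0 ≤ γ) {t : ℝ} (ht : 0 < t) (ht1 : t ≤ 1) :
    t ^ γ ≤ levelScale γ (dyadicLevel t) := by
  rw [levelScale_eq]
  refine Real.rpow_le_rpow ht.le ?_ hγ
  have h1 : 1 ≤ t⁻¹ := (one_le_inv₀ ht).2 ht1
  have h2 : ⌊t⁻¹⌋₊ ≠ 0 := (Nat.floor_pos.2 h1).ne'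
  have h3 : ((2 : ℝ) ^ dyadicLevel t) ≤ t⁻¹ := by
    refine le_trans ?_ (Nat.floor_le (inv_nonneg.2 ht.le))
    exact_mod_cast Nat.pow_log_le_self 2 h2
  rwa [le_inv_comm₀ ht (by positivity)]

lemma levelScale_le_rpow {γ : ℝ} (hγ : 0 ≤ γ) (hγ1 : γ ≤ 1) {t : ℝ} (ht : 0 < t) :
    levelScale γ (dyadicLevel t) ≤ 2 * t ^ γ := by
  rw [levelScale_eq]
  have h3 : t⁻¹ < (2 : ℝ) ^ (dyadicLevel t + 1) := by
    refine (Nat.lt_floor_add_one _).trans_le ?_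
    exact_mod_cast Nat.lt_pow_succ_log_self one_lt_two ⌊t⁻¹⌋₊
  have h4 : ((2 : ℝ) ^ dyadicLevel t)⁻¹ ≤ 2 * t := by
    rw [inv_le_comm₀ (by positivity) (by positivity), mul_inv, ← div_eq_inv_mul,
      div_le_iff₀ two_pos, ← pow_succ]
    exact h3.le
  calc (((2 : ℝ) ^ dyadicLevel t)⁻¹) ^ γ ≤ (2 * t) ^ γ :=
        Real.rpow_le_rpow (by positivity) h4 hγ
    _ = 2 ^ γ * t ^ γ := Real.mul_rpow zero_le_two ht.le
    _ ≤ 2 * t ^ γ := by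
        gcongr
        simpa using Real.rpow_le_rpow_of_exponent_le one_le_two hγ1

/-- The drift that pushes away from the origin along the curves `± t ^ γ e_i`. -/
noncomputable def repulsiveDrift (i : Fin d) (γ t : ℝ) : Space d → Space d :=
  scaledProfile i (γ * t ^ (γ - 1)) (levelScale γ (dyadicLevel t))

lemma measurable_levelScale_dyadicLevel (γ : ℝ) :
    Measurable fun t => levelScale γ (dyadicLevel t) :=
  (measurable_of_countable (levelScale γ)).comp measurable_dyadicLevel

lemma measurable_repulsiveDrift (i : Fin d) (γ : ℝ) :
    Measurable fun z : ℝ × Space d => repulsiveDrift i γ z.1 z.2 := by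
  have h1 : Measurable fun z : ℝ × Space d => levelScale γ (dyadicLevel z.1) :=
    (measurable_levelScale_dyadicLevel γ).comp measurable_fst
  exact (((measurable_fst.pow_const (γ - 1)).const_mul γ).mul
    ((continuous_profile i).measurable.comp (h1.inv.smul measurable_snd))).smul_const _

lemma isPointwiseDrift_repulsiveDrift (i : Fin d) (γ : ℝ) :
    IsPointwiseDrift fun t : I => repulsiveDrift i γ t :=
  ⟨(measurable_repulsiveDrift i γ).comp
    ((measurable_subtype_coe.comp measurable_fst).prodMk measurable_snd),
    fun _ => continuous_scaledProfile i _ _⟩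

/-- The scale lies between t^γ and 2 t^γ; the sign of θ decides which of the two bounds is used. -/
lemma levelScale_rpow_le {γ : ℝ} (hγ : 0 ≤ γ) (hγ1 : γ ≤ 1) (θ : ℝ) {t : ℝ} (ht : 0 < t)
    (ht1 : t ≤ 1) : levelScale γ (dyadicLevel t) ^ θ ≤ 2 ^ |θ| * t ^ (γ * θ) := by
  rw [Real.rpow_mul ht.le]
  rcases le_total 0 θ with h | h
  · rw [abs_of_nonneg h, ← Real.mul_rpow zero_le_two (by positivity)]
    exact Real.rpow_le_rpow (levelScale_pos _ _).le (levelScale_le_rpow hγ hγ1 ht) h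
  · refine (Real.rpow_le_rpow_of_nonpos (by positivity) (rpow_le_levelScale hγ ht ht1) h).trans ?_
    exact le_mul_of_one_le_left (by positivity) (Real.one_le_rpow one_le_two (abs_nonneg _))

theorem memBochner_repulsiveDrift {mem : (Space d → Space d) → Prop}
    {nrm : (Space d → Space d) → ℝ≥0∞} {q : ℝ≥0∞} (i : Fin d) {γ C θ : ℝ} (hγ : 0 < γ)
    (hγ1 : γ ≤ 1) (hC : 0 ≤ C) (hmem : ∀ a lam, 0 < lam → lam ≤ 1 → mem (scaledProfile i a lam))
    (hnrm : ∀ a lam, 0 < lam → lam ≤ 1 →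
      nrm (scaledProfile i a lam) ≤ ENNReal.ofReal (C * |a| * lam ^ θ))
    (hq : 1 ≤ q) (hθ : -(q⁻¹).toReal < γ - 1 + γ * θ) :
    MemBochner mem nrm q fun t : I => repulsiveDrift i γ t := by
  refine ⟨Eventually.of_forall fun t =>
    hmem _ _ (levelScale_pos _ _) (levelScale_le_one hγ.le _), ?_, ?_⟩
  -- The pair (amplitude, level) is approximated by simple functions. Levels are discrete, so the
  -- approximate level is eventually exact, and the error is then a profile at the correct scale
  -- with amplitude tending to 0. This is why the scale is piecewise constant in time.
  · have hpair : StronglyMeasurable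
        fun t : I => (γ * (t : ℝ) ^ (γ - 1), dyadicLevel (t : ℝ)) :=
      (((measurable_subtype_coe.pow_const (γ - 1)).const_mul γ).prodMk
        (measurable_dyadicLevel.comp measurable_subtype_coe)).stronglyMeasurable
    refine ⟨fun n => (hpair.approx n).map fun p => scaledProfile i p.1 (levelScale γ p.2),
      fun n t => hmem _ _ (levelScale_pos _ _) (levelScale_le_one hγ.le _),
      Eventually.of_forall fun t => ?_⟩
    have hlim := hpair.tendsto_approx t
    rw [nhds_prod_eq, tendsto_prod_iff'] at hlim
    obtain ⟨hlim1, hlim2⟩ := hlim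
    simp only [nhds_discrete, tendsto_pure] at hlim2
    have h0 : Tendsto (fun n => ENNReal.ofReal
        (C * |γ * (t : ℝ) ^ (γ - 1) - (hpair.approx n t).1| *
          levelScale γ (dyadicLevel t) ^ θ)) atTop (𝓝 0) := by
      have h1 := (((tendsto_const_nhds (x := γ * (t : ℝ) ^ (γ - 1))).sub hlim1).abs.const_mul
        C).mul_const (levelScale γ (dyadicLevel t) ^ θ)
      rw [sub_self, abs_zero, mul_zero, zero_mul] at h1
      simpa using ENNReal.tendsto_ofReal h1
    refine tendsto_of_tendsto_of_tendsto_of_le_of_le' tendsto_const_nhds h0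
      (Eventually.of_forall fun _ => zero_le) ?_
    filter_upwards [hlim2] with n hn
    simp only [SimpleFunc.map_apply, hn, repulsiveDrift, scaledProfile_sub]
    exact hnrm _ _ (levelScale_pos _ _) (levelScale_le_one hγ.le _)
  · have hLp := (memLp_rpow_unitInterval hq hθ).const_mul (C * γ * 2 ^ |θ|)
    refine lt_of_le_of_lt (eLpNorm_mono_enorm_ae ?_) hLp.2
    filter_upwards [ae_unitInterval_pos] with t ht
    rw [Real.enorm_of_nonneg (by have := t.2.1; positivity), enorm_eq_self]
    refine (hnrm _ _ (levelScale_pos _ _) (levelScale_le_one hγ.le _)).trans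
      (ENNReal.ofReal_le_ofReal ?_)
    rw [abs_of_nonneg (by positivity), Real.rpow_add ht]
    calc C * (γ * (t : ℝ) ^ (γ - 1)) * levelScale γ (dyadicLevel t) ^ θ
        ≤ C * (γ * (t : ℝ) ^ (γ - 1)) * (2 ^ |θ| * (t : ℝ) ^ (γ * θ)) := by
          gcongr
          exact levelScale_rpow_le hγ.le hγ1 θ ht t.2.2
      _ = _ := by ring

end Drift

/-! ### The equation along one line: two branches and their continuation. -/

section Forcing

variable {d : ℕ}

/-- The repulsive drift along the line `a ↦ w s + a e_i`, as a scalar. -/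
noncomputable def forcing (i : Fin d) (γ : ℝ) (w : ℝ → Space d) (s a : ℝ) : ℝ :=
  γ * s ^ (γ - 1) * profile i ((levelScale γ (dyadicLevel s))⁻¹ • (w s + a • dir i))

lemma repulsiveDrift_add_smul (i : Fin d) (γ : ℝ) (w : ℝ → Space d) (s a : ℝ) :
    repulsiveDrift i γ s (w s + a • dir i) = forcing i γ w s a • dir i := rfl

lemma abs_forcing_le (i : Fin d) (γ : ℝ) (w : ℝ → Space d) (s a : ℝ) :
    |forcing i γ w s a| ≤ |γ * s ^ (γ - 1)| := by
  rw [forcing, abs_mul]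
  exact mul_le_of_le_one_right (abs_nonneg _) (abs_profile_le_one _ _)

lemma measurable_forcing_comp {α : Type*} [MeasurableSpace α] (i : Fin d) (γ : ℝ)
    {w : α → ℝ → Space d} {τ a : α → ℝ} (hw : Measurable fun x => w x (τ x))
    (hτ : Measurable τ) (ha : Measurable a) :
    Measurable fun x => forcing i γ (w x) (τ x) (a x) :=
  ((hτ.pow_const (γ - 1)).const_mul γ).mul ((continuous_profile i).measurable.comp
    (((measurable_levelScale_dyadicLevel γ).comp hτ).inv.smul (hw.add (ha.smul_const _))))

lemma measurable_forcing (i : Fin d) (γ : ℝ) {w : ℝ → Space d} (hw : Measurable w) :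
    Measurable (Function.uncurry (forcing i γ w)) :=
  measurable_forcing_comp (w := fun _ : ℝ × ℝ => w) i γ (hw.comp measurable_fst) measurable_fst
    measurable_snd

lemma intervalIntegrable_mul_rpow {γ : ℝ} (hγ : 0 < γ) (a b : ℝ) :
    IntervalIntegrable (fun s : ℝ => γ * s ^ (γ - 1)) volume a b :=
  (intervalIntegral.intervalIntegrable_rpow' (by linarith)).const_mul γ

/-- The smallness near time `0` that lets a path follow the curves `± t ^ γ e_i` for a while. -/
def IsSmallNearZero (γ δ : ℝ) (w : ℝ → Space d) : Prop :=
  ∀ s, 0 < s → s ≤ δ → ‖w s‖ ≤ s ^ γ / 4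

/-- After division by the scale, the curve sits at ε times a number in [1/2, 1], and the
perturbation by `w` has norm at most 1/4. There the profile equals ε. -/
lemma forcing_eq (i : Fin d) {γ : ℝ} (hγ : 0 < γ) (hγ1 : γ ≤ 1) {w : ℝ → Space d} {δ : ℝ}
    (hδ : δ ≤ 1) (hw : IsSmallNearZero γ δ w) {ε : ℝ} (hε : ε = 1 ∨ ε = -1) {s : ℝ}
    (hs : 0 < s) (hsδ : s ≤ δ) : forcing i γ w s (ε * s ^ γ) = γ * s ^ (γ - 1) * ε := by
  set lam := levelScale γ (dyadicLevel s) with hlam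
  have hlam0 : 0 < lam := levelScale_pos _ _
  have h1 : s ^ γ ≤ lam := rpow_le_levelScale hγ.le hs (hsδ.trans hδ)
  have h2 : lam ≤ 2 * s ^ γ := levelScale_le_rpow hγ.le hγ1 hs
  rw [forcing, profile_eq_sign i hε (s := s ^ γ / lam)]
  · constructor
    · rw [le_div_iff₀ hlam0]
      linarith
    · exact (div_le_one hlam0).2 h1
  · have h3 : lam⁻¹ • (w s + (ε * s ^ γ) • dir i) - (ε * (s ^ γ / lam)) • dir i =
        lam⁻¹ • w s := by
      rw [smul_add, smul_smul, div_eq_inv_mul, mul_left_comm]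
      abel
    rw [h3, norm_smul, norm_inv, Real.norm_of_nonneg hlam0.le, inv_mul_le_iff₀ hlam0]
    linarith [hw s hs hsδ]

lemma integral_forcing_eq (i : Fin d) {γ : ℝ} (hγ : 0 < γ) (hγ1 : γ ≤ 1) {w : ℝ → Space d}
    {δ : ℝ} (hδ : δ ≤ 1) (hw : IsSmallNearZero γ δ w) {ε : ℝ} (hε : ε = 1 ∨ ε = -1) {t : ℝ}
    (ht : 0 ≤ t) (htδ : t ≤ δ) :
    ∫ s in (0 : ℝ)..t, forcing i γ w s (ε * s ^ γ) = ε * t ^ γ := by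
  have h : ∫ s in (0 : ℝ)..t, forcing i γ w s (ε * s ^ γ) =
      ∫ s in (0 : ℝ)..t, γ * s ^ (γ - 1) * ε := by
    refine intervalIntegral.integral_congr_ae (Eventually.of_forall fun s hs => ?_)
    rw [Set.uIoc_of_le ht] at hs
    exact forcing_eq i hγ hγ1 hδ hw hε hs.1 (hs.2.trans htδ)
  rw [h, intervalIntegral.integral_mul_const, intervalIntegral.integral_const_mul,
    integral_rpow (Or.inl (by linarith)), sub_add_cancel, Real.zero_rpow hγ.ne', sub_zero]
  field_simp

/-- The slope is at most a multiple of s^(γ-1) / s^γ = 1/s. This bound is not integrable at 0, which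
leaves room for branching, but it is bounded on [δ, 1]. -/
lemma exists_forcing_lipschitz (i : Fin d) {γ : ℝ} (hγ : 0 < γ) (hγ1 : γ ≤ 1)
    (w : ℝ → Space d) {δ : ℝ} (hδ : 0 < δ) : ∃ L, 0 < L ∧ ∀ s, δ ≤ s → s ≤ 1 → ∀ a a',
      |forcing i γ w s a - forcing i γ w s a'| ≤ L * |a - a'| := by
  obtain ⟨K, hK⟩ := exists_lipschitzWith_profile i
  -- The added 1 only makes the constant strictly positive.
  refine ⟨δ⁻¹ * (K + 1), by positivity, fun s hs hs1 a a' => ?_⟩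
  have hs0 : 0 < s := hδ.trans_le hs
  set lam := levelScale γ (dyadicLevel s) with hlam
  have hlam0 : 0 < lam := levelScale_pos _ _
  have h1 : s ^ γ ≤ lam := rpow_le_levelScale hγ.le hs0 hs1
  have h2 := hK.dist_le_mul (lam⁻¹ • (w s + a • dir i)) (lam⁻¹ • (w s + a' • dir i))
  rw [dist_eq_norm, dist_eq_norm, ← smul_sub, add_sub_add_left_eq_sub, ← sub_smul, norm_smul,
    norm_smul, norm_dir, mul_one, norm_inv, Real.norm_of_nonneg hlam0.le, Real.norm_eq_abs,
    Real.norm_eq_abs] at h2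
  have h3 : γ * s ^ (γ - 1) * lam⁻¹ ≤ δ⁻¹ := by
    rw [Real.rpow_sub_one hs0.ne', ← div_eq_mul_inv, div_le_iff₀ hlam0]
    calc γ * (s ^ γ / s) ≤ 1 * (s ^ γ / s) := by gcongr
      _ = s⁻¹ * s ^ γ := by rw [one_mul, div_eq_inv_mul]
      _ ≤ δ⁻¹ * lam := by gcongr
  rw [forcing, forcing, ← mul_sub, abs_mul, abs_of_nonneg (by positivity)]
  calc _ ≤ γ * s ^ (γ - 1) * (K * (lam⁻¹ * |a - a'|)) := by gcongr
    _ = (γ * s ^ (γ - 1) * lam⁻¹) * (K * |a - a'|) := by ring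
    _ ≤ δ⁻¹ * ((K + 1) * |a - a'|) := by gcongr; linarith
    _ = _ := by ring

/-- The displacement along `e_i` of the solution that starts along `ε t ^ γ e_i`. -/
noncomputable def displacement (i : Fin d) (γ ε : ℝ) (w : ℝ → Space d) (t : ℝ) : ℝ :=
  limUnder atTop fun k => picard (forcing i γ w) (fun s => ε * s ^ γ) k t

lemma continuous_picard_forcing (i : Fin d) {γ : ℝ} (hγ : 0 < γ) {w : ℝ → Space d}
    (hw : Measurable w) (ε : ℝ) (k : ℕ) :
    Continuous (picard (forcing i γ w) (fun s => ε * s ^ γ) k) :=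
  continuous_picard (measurable_forcing i γ hw) (abs_forcing_le i γ w)
    (intervalIntegrable_mul_rpow hγ)
    (continuous_const.mul (Real.continuous_rpow_const hγ.le)) k

/-- The displacement solves the integral equation driven by `w`. -/
theorem displacement_spec (i : Fin d) {γ : ℝ} (hγ : 0 < γ) (hγ1 : γ ≤ 1) {w : ℝ → Space d}
    (hwm : Measurable w) {δ : ℝ} (hδ0 : 0 < δ) (hδ : δ ≤ 1) (hw : IsSmallNearZero γ δ w)
    {ε : ℝ} (hε : ε = 1 ∨ ε = -1) :
    (∀ t ∈ Set.Icc (0 : ℝ) 1, Tendsto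
      (fun k => picard (forcing i γ w) (fun s => ε * s ^ γ) k t) atTop
        (𝓝 (displacement i γ ε w t))) ∧
    (∀ t, 0 ≤ t → t ≤ δ → displacement i γ ε w t = ε * t ^ γ) ∧
    (∀ t ∈ Set.Icc (0 : ℝ) 1, IntervalIntegrable
      (fun s => forcing i γ w s (displacement i γ ε w s)) volume 0 t) ∧
    (∀ t ∈ Set.Icc (0 : ℝ) 1, displacement i γ ε w t =
      ∫ s in (0 : ℝ)..t, forcing i γ w s (displacement i γ ε w s)) ∧
    ContinuousOn (displacement i γ ε w) (Set.Icc 0 1) := by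
  have hf := measurable_forcing i γ hwm
  obtain ⟨L, hL, hlip⟩ := exists_forcing_lipschitz i hγ hγ1 w hδ0
  obtain ⟨y, hym, hy1, hy2, hy3⟩ := exists_tendsto_picard hf (abs_forcing_le i γ w)
    (intervalIntegrable_mul_rpow hγ)
    (continuous_const.mul (Real.continuous_rpow_const hγ.le)) hL
    (fun t ht htδ => integral_forcing_eq i hγ hγ1 hδ hw hε ht htδ) hlip
  have heq : ∀ t ∈ Set.Icc (0 : ℝ) 1, displacement i γ ε w t = y t := fun t ht =>
    (hy1 t ht).limUnder_eq
  have hint := intervalIntegrable_comp_of_bound hf (abs_forcing_le i γ w)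
    (intervalIntegrable_mul_rpow hγ) hym
  refine ⟨fun t ht => ?_, fun t ht htδ => ?_, fun t ht => ?_, fun t ht => ?_, ?_⟩
  · rw [heq t ht]
    exact hy1 t ht
  · rw [heq t ⟨ht, htδ.trans hδ⟩]
    exact hy2 t ht htδ (htδ.trans hδ)
  · refine (hint 0 t).congr fun s hs => ?_
    rw [Set.uIoc_of_le ht.1] at hs
    simp only [heq s ⟨hs.1.le, hs.2.trans ht.2⟩]
  · rw [heq t ht, hy3 t ht]
    refine intervalIntegral.integral_congr fun s hs => ?_
    rw [Set.uIcc_of_le ht.1] at hs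
    simp only [heq s ⟨hs.1, hs.2.trans ht.2⟩]
  · exact (intervalIntegral.continuous_primitive hint 0).continuousOn.congr
      fun t ht => (heq t ht).trans (hy3 t ht)

/-- The displacement at time `T` is measurable with respect to the noise up to time `T`. -/
lemma measurable_displacement {Ω : Type*} [MeasurableSpace Ω] (i : Fin d) {γ : ℝ} (hγ : 0 < γ)
    {w : Ω → ℝ → Space d} (hw : ∀ ω, Continuous (w ω)) (ε : ℝ) {T : ℝ} (hT : 0 ≤ T)
    (hwT : ∀ s, 0 ≤ s → s ≤ T → Measurable fun ω => w ω s)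
    (hlim : ∀ ω, Tendsto (fun k => picard (forcing i γ (w ω)) (fun s => ε * s ^ γ) k T) atTop
      (𝓝 (displacement i γ ε (w ω) T))) :
    Measurable fun ω => displacement i γ ε (w ω) T := by
  have hclamp : Measurable fun p : Ω × ℝ × ℝ => max 0 (min p.2.1 T) :=
    measurable_const.max (measurable_snd.fst.min measurable_const)
  have hu : Measurable (Function.uncurry fun (s : ℝ) (ω : Ω) => w ω (max 0 (min s T))) := by
    refine measurable_uncurry_of_continuous_of_measurable (fun ω => ?_) fun s => ?_
    · exact (hw ω).comp (by fun_prop)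
    · exact hwT _ (le_max_left _ _) (max_le hT (min_le_right _ _))
  refine measurable_of_tendsto_metrizable
    (f := fun k ω => picard (forcing i γ (w ω)) (fun s => ε * s ^ γ) k T) (fun k => ?_)
    (tendsto_pi_nhds.2 hlim)
  refine measurable_picard
    (fun ω k => continuous_picard_forcing i hγ (hw ω).measurable ε k) ?_ k T hT le_rfl
  exact measurable_forcing_comp (w := fun p : Ω × ℝ × ℝ => w p.1) i γ
    (hu.comp (measurable_snd.fst.prodMk measurable_fst)) hclamp measurable_snd.snd

end Forcing

/-! ### From paths to weak solutions and their laws. -/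

section WeakSolution

variable {d : ℕ}

/-- A path on `[0, 1]`, extended to `ℝ` by constants. -/
noncomputable def extendPath (x : I → Space d) (s : ℝ) : Space d :=
  x (Set.projIcc 0 1 zero_le_one s)

lemma extendPath_coe (x : I → Space d) (t : I) : extendPath x t = x t := by
  rw [extendPath, Set.projIcc_val]

lemma continuous_extendPath {x : I → Space d} (hx : Continuous x) : Continuous (extendPath x) :=
  hx.comp continuous_projIcc

/-- The paths for which the integral equation is solved. -/
def IsGoodPath (γ : ℝ) (x : I → Space d) : Prop :=
  Continuous x ∧ ∃ δ, 0 < δ ∧ δ ≤ 1 ∧ IsSmallNearZero γ δ (extendPath x)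

lemma isGoodPath_zero (γ : ℝ) : IsGoodPath γ (0 : I → Space d) :=
  ⟨continuous_const, 1, one_pos, le_rfl, fun s hs _ => by
    simp only [extendPath, Pi.zero_apply, norm_zero]
    positivity⟩

/-- The surplus exponent gives C s^γ' = C s^(γ'-γ) s^γ, and the factor C s^(γ'-γ) drops below 1/4
near 0. -/
lemma isGoodPath_of_holderWith {γ : ℝ} {γ' C : ℝ≥0} (hγ : 0 ≤ γ) (hγ' : γ < γ')
    {x : I → Space d} (hx : HolderWith C γ' x) (hx0 : x 0 = 0) : IsGoodPath γ x := by
  have hpos : 0 < (γ' : ℝ) - γ := sub_pos.2 hγ'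
  have hlim : Tendsto (fun s : ℝ => C * s ^ ((γ' : ℝ) - γ)) (𝓝 0) (𝓝 0) := by
    have := ((Real.continuous_rpow_const hpos.le).tendsto 0).const_mul (C : ℝ)
    rwa [Real.zero_rpow hpos.ne', mul_zero] at this
  obtain ⟨δ, hδ, hball⟩ := Metric.eventually_nhds_iff.1
    (hlim.eventually (gt_mem_nhds (show (0 : ℝ) < 1 / 4 by norm_num)))
  refine ⟨hx.continuous (by exact_mod_cast hγ.trans_lt hγ'), min (δ / 2) 1, by positivity,
    min_le_right _ _, fun s hs hsδ => ?_⟩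
  have hs1 : s ≤ 1 := hsδ.trans (min_le_right _ _)
  have hs2 : s ≤ δ / 2 := hsδ.trans (min_le_left _ _)
  have h1 : C * s ^ ((γ' : ℝ) - γ) < 1 / 4 := hball (by
    rw [dist_zero_right, Real.norm_of_nonneg hs.le]
    linarith)
  have h2 := hx.dist_le ⟨s, hs.le, hs1⟩ 0
  rw [hx0, dist_zero_right] at h2
  have h3 : dist (⟨s, hs.le, hs1⟩ : I) 0 = s := by
    rw [Subtype.dist_eq, Real.dist_eq]
    simp [abs_of_pos hs]
  rw [h3] at h2
  rw [extendPath, Set.projIcc_of_mem _ ⟨hs.le, hs1⟩]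
  refine h2.trans ?_
  calc C * s ^ (γ' : ℝ) = C * s ^ ((γ' : ℝ) - γ) * s ^ γ := by
        rw [mul_assoc, ← Real.rpow_add hs, sub_add_cancel]
    _ ≤ 1 / 4 * s ^ γ := by gcongr
    _ = s ^ γ / 4 := by ring

variable {Ω : Type*}

open Classical in
/-- The solution of the equation with the repulsive drift that starts along `ε t ^ γ e_i`. -/
noncomputable def repulsiveSolution (i : Fin d) (γ ε : ℝ) (B : I → Ω → Space d) (t : I) (ω : Ω) :
    Space d :=
  B t ω + displacement i γ ε
    (extendPath (if IsGoodPath γ (fun s => B s ω) then fun s => B s ω else 0)) t • dir i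

lemma repulsiveSolution_of_isGoodPath (i : Fin d) {γ ε : ℝ} {B : I → Ω → Space d} {ω : Ω}
    (h : IsGoodPath γ (fun s => B s ω)) (t : I) : repulsiveSolution i γ ε B t ω =
      B t ω + displacement i γ ε (extendPath fun s => B s ω) t • dir i := by
  rw [repulsiveSolution, if_pos h]

/-- The times `1 / (n + 1)`. -/
noncomputable def invTime (n : ℕ) : I :=
  ⟨1 / ((n : ℝ) + 1), by positivity, by
    rw [div_le_one (by positivity)]
    linarith [Nat.cast_nonneg (α := ℝ) n]⟩

/-- Near time 0 the displacement is exactly ε s^γ, while the noise is at most s^γ / 4, too small to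
change the sign. -/
lemma repulsiveSolution_sign (i : Fin d) {γ : ℝ} (hγ : 0 < γ) (hγ1 : γ ≤ 1) {ε : ℝ}
    (hε : ε = 1 ∨ ε = -1) {B : I → Ω → Space d} {ω : Ω}
    (hω : IsGoodPath γ (fun s => B s ω)) :
    ∀ᶠ n in atTop, 0 < ε * repulsiveSolution i γ ε B (invTime n) ω i := by
  simp only [repulsiveSolution_of_isGoodPath i hω]
  obtain ⟨hc, δ, hδ0, hδ1, hsmall⟩ := hω
  obtain ⟨-, hinit, -, -, -⟩ := displacement_spec i hγ hγ1
    (continuous_extendPath hc).measurable hδ0 hδ1 hsmall hε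
  filter_upwards [(tendsto_one_div_add_atTop_nhds_zero_nat (𝕜 := ℝ)).eventually
    (gt_mem_nhds hδ0)] with n hn
  have hs : (0 : ℝ) < invTime n := by
    simp only [invTime]
    positivity
  have hsδ : (invTime n : ℝ) ≤ δ := le_of_lt hn
  rw [hinit _ hs.le hsδ]
  have h1 := hsmall _ hs hsδ
  rw [extendPath_coe] at h1
  have h2 := (PiLp.norm_apply_le (B (invTime n) ω) i).trans h1
  rw [Real.norm_eq_abs, abs_le] at h2
  have h3 : 0 < (invTime n : ℝ) ^ γ := Real.rpow_pos_of_pos hs γ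
  simp only [PiLp.add_apply, PiLp.smul_apply, PiLp.single_apply, if_true, smul_eq_mul,
    mul_one]
  rcases hε with rfl | rfl <;> linarith [h2.1, h2.2]

variable [MeasurableSpace Ω]

theorem isWeakSolution_repulsiveSolution (i : Fin d) {γ : ℝ} (hγ : 0 < γ) (hγ1 : γ ≤ 1) {ε : ℝ}
    (hε : ε = 1 ∨ ε = -1) {P : Measure Ω} [IsProbabilityMeasure P] [P.IsComplete]
    {B : I → Ω → Space d} (hB : ∀ t, StronglyMeasurable (B t))
    (hgood : ∀ᵐ ω ∂P, IsGoodPath γ (fun s => B s ω)) :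
    IsWeakSolution (fun t : I => repulsiveDrift i γ t) 0 (law P B) P
      (augmentation P (Filtration.natural B hB).rightCont) (repulsiveSolution i γ ε B) B where
  isProbabilityMeasure := inferInstance
  complete A hA := measurableSet_augmentation_of_null _ _ hA
  rightContinuous := augmentation_rightCont_isRightContinuous P _
  adapted t := by
    classical
    set 𝔽 := augmentation P (Filtration.natural B hB).rightCont with h𝔽
    have hBad : ∀ s ≤ t, Measurable[𝔽 t] (B s) := fun s hs =>
      (((Filtration.stronglyAdapted_natural hB s).mono
        ((Filtration.natural B hB).le_rightCont s)).mono
          ((le_augmentation P _ s).trans (𝔽.mono hs))).measurable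
    set w : Ω → ℝ → Space d := fun ω =>
      extendPath (if IsGoodPath γ (fun s => B s ω) then fun s => B s ω else 0) with hw
    -- Replacing bad paths by the zero path makes the Picard iterates converge for every ω. The
    -- replacement concerns a null set, so completeness of the filtration preserves adaptedness.
    have hwgood : ∀ ω, IsGoodPath γ
        (if IsGoodPath γ (fun s => B s ω) then fun s => B s ω else (0 : I → Space d)) := by
      intro ω
      split_ifs with h
      · exact h
      · exact isGoodPath_zero γ
    have hdisp : Measurable[𝔽 t] fun ω => displacement i γ ε (w ω) t := by
      refine @measurable_displacement d Ω (𝔽 t) i γ hγ w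
        (fun ω => continuous_extendPath (hwgood ω).1) ε t t.2.1 (fun s hs0 hst => ?_)
        (fun ω => ?_)
      · refine measurable_augmentation_congr _ t
          (hBad (Set.projIcc 0 1 zero_le_one s) ?_) ?_
        · exact Subtype.coe_le_coe.1 (by
            rw [Set.projIcc_of_mem _ ⟨hs0, hst.trans t.2.2⟩]
            exact hst)
        · filter_upwards [hgood] with ω hω
          simp only [hw, if_pos hω, extendPath]
      · obtain ⟨hc, δ, hδ0, hδ1, hsmall⟩ := hwgood ω
        exact (displacement_spec i hγ hγ1 (continuous_extendPath hc).measurable hδ0 hδ1 hsmall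
          hε).1 t t.2
    exact ((hBad t le_rfl).add (hdisp.smul_const _)).stronglyMeasurable
  noise_adapted t := ((Filtration.stronglyAdapted_natural hB t).mono
    ((Filtration.natural B hB).le_rightCont t)).mono (le_augmentation P _ t)
  noise_measurable := hB
  noise_law := rfl
  nonanticipating t A hA := condExp_augmentation P _ t
    ((integrable_const (1 : ℝ)).indicator ((Filtration.natural B hB).le 1 A hA))
  continuous := by
    filter_upwards [hgood] with ω hω
    simp only [repulsiveSolution_of_isGoodPath i hω]
    obtain ⟨hc, δ, hδ0, hδ1, hsmall⟩ := hω
    have h := (displacement_spec i hγ hγ1 (continuous_extendPath hc).measurable hδ0 hδ1 hsmall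
      hε).2.2.2.2
    exact hc.add ((continuousOn_iff_continuous_domRestrict.1 h).smul continuous_const)
  equation := by
    filter_upwards [hgood] with ω hω t
    set w := extendPath fun s => B s ω with hw
    have hdrift : (fun s : I => repulsiveDrift i γ s (repulsiveSolution i γ ε B s ω)) =
        fun s : I => forcing i γ w s (displacement i γ ε w s) • dir i := by
      funext s
      rw [repulsiveSolution_of_isGoodPath i hω, ← repulsiveDrift_add_smul, hw, extendPath_coe]
    rw [repulsiveSolution_of_isGoodPath i hω]
    obtain ⟨hc, δ, hδ0, hδ1, hsmall⟩ := hω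
    obtain ⟨-, -, hint, heq, -⟩ := displacement_spec i hγ hγ1
      (continuous_extendPath hc).measurable hδ0 hδ1 hsmall hε
    refine ⟨?_, ?_⟩
    · simp only [hdrift]
      exact Integrable.smul_const (integrableOn_Iic_unitInterval (hint t t.2)) _
    · simp only [hdrift]
      rw [integral_smul_const, setIntegral_Iic_unitInterval
        (fun s => forcing i γ w s (displacement i γ ε w s)), ← heq t t.2, zero_add, add_comm]

/-- The two solutions have mutually singular laws. -/
theorem mutuallySingular_law_repulsiveSolution (i : Fin d) {γ : ℝ} (hγ : 0 < γ) (hγ1 : γ ≤ 1)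
    {P : Measure Ω} {B : I → Ω → Space d} (hgood : ∀ᵐ ω ∂P, IsGoodPath γ (fun s => B s ω))
    (hmeas : ∀ ε : ℝ, ε = 1 ∨ ε = -1 → ∀ t, Measurable (repulsiveSolution i γ ε B t)) :
    law P (repulsiveSolution i γ 1 B) ⟂ₘ law P (repulsiveSolution i γ (-1) B) := by
  -- Only countably many times are tested, so the event is measurable for the σ-algebra generated by
  -- evaluations.
  set S : Set (I → Space d) := {x | ∀ᶠ n in atTop, 0 < x (invTime n) i} with hS
  have hSm : MeasurableSet S := by
    have : S = ⋃ N : ℕ, ⋂ n : ℕ, ⋂ _ : N ≤ n, {x | 0 < x (invTime n) i} := by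
      ext x
      simp [hS, eventually_atTop]
    rw [this]
    refine MeasurableSet.iUnion fun N => MeasurableSet.iInter fun n => MeasurableSet.iInter
      fun _ => measurableSet_lt measurable_const ?_
    exact (EuclideanSpace.proj (𝕜 := ℝ) i).continuous.measurable.comp (measurable_pi_apply _)
  refine ⟨Sᶜ, hSm.compl, ?_, ?_⟩
  · rw [law, Measure.map_apply (measurable_pi_lambda _ (hmeas 1 (Or.inl rfl))) hSm.compl]
    refine measure_mono_null ?_ hgood
    intro ω hω hgoodω
    have h := repulsiveSolution_sign i hγ hγ1 (Or.inl rfl) hgoodω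
    simp only [one_mul] at h
    exact hω h
  · rw [compl_compl, law, Measure.map_apply (measurable_pi_lambda _ (hmeas (-1) (Or.inr rfl))) hSm]
    refine measure_mono_null ?_ hgood
    intro ω hω hgoodω
    have h := repulsiveSolution_sign i hγ hγ1 (Or.inr rfl) hgoodω
    obtain ⟨n, h1, h2⟩ := (h.and hω).exists
    linarith

lemma law_completion {P : Measure Ω} {B : I → Ω → Space d} (hB : ∀ t, Measurable (B t)) :
    law (Ω := NullMeasurableSpace Ω P) P.completion B = law P B := by
  have h := measurable_pi_lambda (fun ω t => B t ω) hB
  have h' : Measurable (fun (ω : NullMeasurableSpace Ω P) t => B t ω) :=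
    fun s hs => (h hs).nullMeasurableSet
  ext s hs
  unfold law
  rw [Measure.map_apply h hs, Measure.map_apply h' hs]
  rfl

end WeakSolution

/-- Non-uniqueness in law for the equation with the repulsive drift. -/
theorem exists_mutuallySingular_solution_laws {d : ℕ} (i : Fin d) {γ : ℝ} (hγ : 0 < γ)
    (hγ1 : γ ≤ 1) {Ω : Type u} [MeasurableSpace Ω] (P : Measure Ω) [IsProbabilityMeasure P]
    {B : I → Ω → Space d} (hB : ∀ t, Measurable (B t))
    (hgood : ∀ᵐ ω ∂P, IsGoodPath γ (fun s => B s ω)) :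
    ∃ μ₁ μ₂ : Measure (I → Space d),
      IsWeakSolutionLaw.{u} (fun t : I => repulsiveDrift i γ t) 0 (law P B) μ₁ ∧
      IsWeakSolutionLaw.{u} (fun t : I => repulsiveDrift i γ t) 0 (law P B) μ₂ ∧
      μ₁ ≠ μ₂ ∧ μ₁ ⟂ₘ μ₂ := by
  -- The augmentation requires a complete measure; passing to the completion does not change the law
  -- of the noise.
  let Ω' : Type u := NullMeasurableSpace Ω P
  let P' : Measure Ω' := P.completion
  have : IsProbabilityMeasure P' := ⟨by
    change P Set.univ = 1
    exact measure_univ⟩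
  have : P'.IsComplete := Measure.completion.isComplete P
  let B' : I → Ω' → Space d := B
  have hB' : ∀ t, StronglyMeasurable (B' t) := fun t =>
    Measurable.stronglyMeasurable fun s hs => (hB t hs).nullMeasurableSet
  have hgood' : ∀ᵐ ω ∂P', IsGoodPath γ (fun s => B' s ω) := hgood
  have hlaw : law P' B' = law P B := law_completion hB
  have hsol := fun (ε : ℝ) (hε : ε = 1 ∨ ε = -1) =>
    isWeakSolution_repulsiveSolution i hγ hγ1 hε hB' hgood'
  have hmeas : ∀ ε : ℝ, ε = 1 ∨ ε = -1 → ∀ t, Measurable (repulsiveSolution i γ ε B' t) :=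
    fun ε hε t => ((hsol ε hε).adapted t).measurable.mono (Filtration.le _ t) le_rfl
  have hsing := mutuallySingular_law_repulsiveSolution i hγ hγ1 hgood' hmeas
  refine ⟨_, _, ⟨Ω', _, P', _, _, B', hlaw ▸ hsol 1 (Or.inl rfl), rfl⟩,
    ⟨Ω', _, P', _, _, B', hlaw ▸ hsol (-1) (Or.inr rfl), rfl⟩, fun heq => ?_, hsing⟩
  have : IsProbabilityMeasure (law P' (repulsiveSolution i γ 1 B')) :=
    Measure.isProbabilityMeasure_map (measurable_pi_lambda _ (hmeas 1 (Or.inl rfl))).aemeasurable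
  rw [← heq, Measure.MutuallySingular.self_iff] at hsing
  exact IsProbabilityMeasure.ne_zero _ hsing

lemma ae_isGoodPath {d : ℕ} {H γ : ℝ} (hγ : 0 < γ) (hγH : γ < H) {Ω : Type*} [MeasurableSpace Ω]
    {P : Measure Ω} {B : I → Ω → Space d} (hB0 : ∀ᵐ ω ∂P, B 0 ω = 0)
    (hBholder : ∀ᵐ ω ∂P, ∀ γ : ℝ≥0, 0 < γ → (γ : ℝ) < H →
      ∃ C : ℝ≥0, HolderWith C γ (fun t => B t ω)) :
    ∀ᵐ ω ∂P, IsGoodPath γ (fun s => B s ω) := by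
  filter_upwards [hB0, hBholder] with ω h0 hω
  obtain ⟨γ', h1, h2⟩ := exists_between hγH
  lift γ' to ℝ≥0 using (hγ.trans h1).le
  obtain ⟨C, hC⟩ := hω γ' (by exact_mod_cast hγ.trans h1) h2
  exact isGoodPath_of_holderWith hγ.le h1 hC h0

/-- Strict inequalities leave room to lower H to γ. It is applied with m = 1 - 1/q, and κ = 1 - α or
κ = 1 + d/p. -/
lemma exists_exponent {H κ m : ℝ} (hH : 0 < H) (hκ : 0 < κ) (h : m < H * κ) :
    ∃ γ, 0 < γ ∧ γ < H ∧ m < γ * κ := by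
  obtain ⟨γ, h1, h2⟩ := exists_between (max_lt hH ((div_lt_iff₀ hκ).2 h))
  exact ⟨γ, (le_max_left _ _).trans_lt h1, h2, (div_lt_iff₀ hκ).1 ((le_max_right _ _).trans_lt h1)⟩

end SingularSDE

theorem mainTheorem12 {d : ℕ} (hd : 1 ≤ d) (H : ℝ) (hH0 : 0 < H) (hH1 : H < 1)
    {Ω : Type u} [MeasurableSpace Ω] (P : Measure Ω) [IsProbabilityMeasure P]
    (B : I → Ω → SingularSDE.Space d) (hBmeas : ∀ t, Measurable (B t))
    (hB0 : ∀ᵐ ω ∂P, B 0 ω = 0)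
    (hBholder : ∀ᵐ ω ∂P, ∀ γ : ℝ≥0, 0 < γ → (γ : ℝ) < H →
      ∃ C : ℝ≥0, HolderWith C γ (fun t => B t ω)) :
    (∀ q α : ℝ, 1 < q → -1 < α → α < 1 - 1 / (H * q.conjExponent) →
      ∃ b : I → SingularSDE.Space d → SingularSDE.Space d,
        SingularSDE.IsPointwiseDrift b ∧
        SingularSDE.MemLqHolder (ENNReal.ofReal q) α b ∧
        ∃ μ₁ μ₂ : Measure (I → SingularSDE.Space d),
          SingularSDE.IsWeakSolutionLaw.{u} b 0 (SingularSDE.law P B) μ₁ ∧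
          SingularSDE.IsWeakSolutionLaw.{u} b 0 (SingularSDE.law P B) μ₂ ∧
          μ₁ ≠ μ₂ ∧ μ₁ ⟂ₘ μ₂) ∧
    (∀ q p : ℝ≥0∞, 1 ≤ q → 1 ≤ p → (d : ℝ≥0∞) < p →
      1 - H < q⁻¹.toReal + H * d * p⁻¹.toReal →
      ∃ b : I → SingularSDE.Space d → SingularSDE.Space d,
        SingularSDE.IsPointwiseDrift b ∧
        SingularSDE.MemLqLp q p b ∧
        ∃ μ₁ μ₂ : Measure (I → SingularSDE.Space d),
          SingularSDE.IsWeakSolutionLaw.{u} b 0 (SingularSDE.law P B) μ₁ ∧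
          SingularSDE.IsWeakSolutionLaw.{u} b 0 (SingularSDE.law P B) μ₂ ∧
          μ₁ ≠ μ₂ ∧ μ₁ ⟂ₘ μ₂) := by
  let i : Fin d := ⟨0, hd⟩
  refine ⟨fun q α hq hα hαq => ?_, fun q p hq _ _ hqp => ?_⟩
  · have hq0 : 0 < q := one_pos.trans hq
    have hq1 : 0 < q - 1 := sub_pos.2 hq
    have hconj : 1 / (H * q.conjExponent) = (1 - q⁻¹) / H := by
      rw [Real.conjExponent]
      field_simp
    have hm : 1 - q⁻¹ < H * (1 - α) := by
      rw [hconj] at hαq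
      have h : (1 - q⁻¹) / H < 1 - α := by linarith
      rwa [div_lt_iff₀ hH0, mul_comm] at h
    have hinv : q⁻¹ < 1 := inv_lt_one_of_one_lt₀ hq
    have hα1 : α < 1 := by
      by_contra h
      have : H * (1 - α) ≤ 0 := mul_nonpos_of_nonneg_of_nonpos hH0.le (by linarith)
      linarith
    obtain ⟨γ, hγ, hγH, hγm⟩ := SingularSDE.exists_exponent hH0 (sub_pos.2 hα1) hm
    obtain ⟨C, hC, hbound⟩ := SingularSDE.exists_holderNorm_scaledProfile_le hd i hα hα1
    have hγ1 : γ ≤ 1 := (hγH.trans hH1).le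
    refine ⟨_, SingularSDE.isPointwiseDrift_repulsiveDrift i γ,
      SingularSDE.memBochner_repulsiveDrift i hγ hγ1 hC (fun a lam h0 h1 =>
        ⟨SingularSDE.isTempered_scaledProfile i a h0,
          (hbound a lam h0 h1).trans_lt ENNReal.ofReal_lt_top⟩) hbound
        (ENNReal.one_le_ofReal.2 hq.le) ?_,
      SingularSDE.exists_mutuallySingular_solution_laws i hγ hγ1 P hBmeas
        (SingularSDE.ae_isGoodPath hγ hγH hB0 hBholder)⟩
    rw [ENNReal.toReal_inv, ENNReal.toReal_ofReal hq0.le]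
    linarith
  · have hκ : 0 < 1 + d * p⁻¹.toReal := by positivity
    have hm : 1 - q⁻¹.toReal < H * (1 + d * p⁻¹.toReal) := by linarith
    obtain ⟨γ, hγ, hγH, hγm⟩ := SingularSDE.exists_exponent hH0 hκ hm
    obtain ⟨C, hC, hbound⟩ := SingularSDE.exists_eLpNorm_scaledProfile_le i p
    have hγ1 : γ ≤ 1 := (hγH.trans hH1).le
    refine ⟨_, SingularSDE.isPointwiseDrift_repulsiveDrift i γ,
      SingularSDE.memBochner_repulsiveDrift i hγ hγ1 hC (fun a lam h0 _ =>
        SingularSDE.memLp_scaledProfile i a h0 p) (fun a lam h0 _ => hbound a lam h0) hq ?_,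
      SingularSDE.exists_mutuallySingular_solution_laws i hγ hγ1 P hBmeas
        (SingularSDE.ae_isGoodPath hγ hγH hB0 hBholder)⟩
    linarith
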